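/- Let $\mathfrak C=\{0,1\}^{\mathbf N}$ be the Cantor space. For a finite word $m$ in $0,1$ let $I_m=\{m\cdot z: z\in\mathfrak C\}$ be the standard dyadic interval of sequences with prefix $m$; a standard dyadic partition is a finite partition of $\mathfrak C$ into such sets. Thompson's group $V$ is the group of homeomorphisms $v$ of $\mathfrak C$ for which there are standard dyadic partitions $(I_{m_k})_{1\le k\le n}$ and $(I_{w_k})_{1\le k\le n}$ with $v(m_k\cdot z)=w_k\cdot z$ for all $1\le k\le n$ and $z\in\mathfrak C$. For a group $\Gamma$ let $L\Gamma$ be the group of locally constant maps $\mathfrak C\to\Gamma$ under pointwise multiplication, and $\operatorname{supp}(a)=\{x\in\mathfrak C: a(x)\neq e\}$ for $a\in L\Gamma$. Given automorphisms $\alpha_0,\alpha_1$ of $\Gamma$ and a word $m=l_1\cdots l_n$, put $\alpha_m=\alpha_{l_n}\circ\cdots\circ\alpha_{l_1}$. For $v\in V$ and $x\in\mathfrak C$ put $\tau_{v,x}=\alpha_w^{-1}\circ\alpha_m\in\mathrm{Aut}(\Gamma)$, where $m,w$ are words such that $x\in I_m$ and $v(m\cdot z)=w\cdot z$ for all $z\in\mathfrak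 C$ (this does not depend on the choice of $m,w$). The formula $\pi_v(a)(vx)=\tau_{v,x}(a(x))$ defines an action $\pi$ of $V$ on $L\Gamma$ by automorphisms, and the (twisted) fraction group of $(\Gamma,\alpha_0,\alpha_1)$ is the semidirect product $G=L\Gamma\rtimes_\pi V$. **Theorem.** Let $(\Gamma,\alpha_0,\alpha_1)$ and $(\tilde\Gamma,\tilde\alpha_0,\tilde\alpha_1)$ be two groups, each with a pair of automorphisms, let $G=L\Gamma\rtimes V$ and $\tilde G=L\tilde\Gamma\rtimes V$ be their fraction groups, with associated maps $\tau,\tilde\tau$ and actions $\pi,\tilde\pi$, and let $\theta:G\to\tilde G$ be an isomorphism. Then there exist a group morphism $\zeta:G\to Z(\tilde G)$ into the centre of $\tilde G$, a homeomorphism $\varphi$ of $\mathfrak C$ that normalises $V$ (write $\mathrm{ad}_\varphi(v)=\varphi v\varphi^{-1}$), a group isomorphism $\kappa^0:L\Gamma\to L\tilde\Gamma$, and a cocycle $c:V\to L\tilde\Gamma$, i.e. a map with $c_{vw}=c_v\cdot\tilde\pi_{\mathrm{ad}_\varphi(v)}(c_w)$ for all $v,w\in V$, such that $$\theta(av)=\zeta(a)\cdot\kappa^0(a)\cdot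 c_v\cdot\mathrm{ad}_\varphi(v)\qquad\text{for all }a\in L\Gamma,\ v\in V,$$ and such that moreover: 1. $\operatorname{supp}(\kappa^0(a))=\varphi(\operatorname{supp}(a))$ for all $a\in L\Gamma$; 2. there is a family of group isomorphisms $\kappa^0_x:\Gamma\to\tilde\Gamma$, $x\in\mathfrak C$, with $\kappa^0(a)(\varphi(x))=\kappa^0_x(a(x))$ for all $a\in L\Gamma$, $x\in\mathfrak C$; 3. for all $x\in\mathfrak C$ and $v\in V$, $$\kappa^0_{vx}\circ\tau_{v,x}=\mathrm{ad}(c_v(\varphi(vx)))\circ\tilde\tau_{\mathrm{ad}_\varphi(v),\varphi(x)}\circ\kappa^0_x,$$ where $\mathrm{ad}(h)(g)=hgh^{-1}$. -/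

import Mathlib

/-- The Cantor space `{0,1}^ℕ` with the product topology (`false` is `0`, `true` is `1`). -/
abbrev Cantor : Type := ℕ → Bool

namespace Cantor

/-- The sequence `b · x` for a letter `b` and an infinite sequence `x`. -/
def cons (b : Bool) (x : Cantor) : Cantor
  | 0 => b
  | n + 1 => x n

/-- The concatenation `m · x` of a finite word `m` and an infinite sequence `x`. -/
def prepend : List Bool → Cantor → Cantor
  | [], x => x
  | b :: m, x => cons b (prepend m x)

/-- The standard dyadic interval of all the sequences with prefix `m`. -/
def sdi (m : List Bool) : Set Cantor := Set.range (prepend m)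

/-- The standard dyadic intervals with words `m 0, …, m (n-1)` form a partition of the Cantor
space. -/
def IsSdp {n : ℕ} (m : Fin n → List Bool) : Prop := ∀ x : Cantor, ∃! k, x ∈ sdi (m k)

/-- The map `v` replaces the prefix `m` by the prefix `w`: the standard dyadic interval of `m`
is adapted to `v`, and its image is the standard dyadic interval of `w`. -/
def Adapted (v : Cantor → Cantor) (m w : List Bool) : Prop :=
  ∀ z : Cantor, v (prepend m z) = prepend w z

theorem cons_inj {a b : Bool} {x y : Cantor} (h : cons a x = cons b y) : a = b ∧ x = y :=
  ⟨congrFun h 0, funext fun n => congrFun h (n + 1)⟩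

theorem cons_head_tail (x : Cantor) : cons (x 0) (fun n => x (n + 1)) = x := by
  funext n; cases n <;> rfl

theorem prepend_append (m w : List Bool) (x : Cantor) :
    prepend (m ++ w) x = prepend m (prepend w x) := by
  induction m with
  | nil => rfl
  | cons b m ih => simp [prepend, ih]

theorem prepend_compare {a b : List Bool} {y z : Cantor} (h : prepend a y = prepend b z) :
    (∃ u, b = a ++ u ∧ y = prepend u z) ∨ (∃ u, a = b ++ u ∧ z = prepend u y) := by
  induction a generalizing b with
  | nil => exact Or.inl ⟨b, rfl, h⟩
  | cons c a ih =>
    cases b with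
    | nil => exact Or.inr ⟨c :: a, rfl, h.symm⟩
    | cons d b =>
      obtain ⟨rfl, h'⟩ := cons_inj h
      rcases ih h' with ⟨u, rfl, hu⟩ | ⟨u, rfl, hu⟩
      · exact Or.inl ⟨u, rfl, hu⟩
      · exact Or.inr ⟨u, rfl, hu⟩

theorem eq_nil_of_prepend {u : List Bool} (h : ∀ z, z = prepend u z) : u = [] := by
  cases u with
  | nil => rfl
  | cons b u =>
    have h0 := congrFun (h fun _ => !b) 0
    simp [prepend, cons] at h0

theorem word_ext {a b : List Bool} (h : ∀ z, prepend a z = prepend b z) : a = b := by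
  have key : ∀ {a b : List Bool} {u : List Bool}, (∀ z, prepend a z = prepend b z) →
      b = a ++ u → a = b := by
    intro a b u h hb
    have hu : u = [] := by
      refine eq_nil_of_prepend fun z => ?_
      have hz := h z
      rw [hb, prepend_append] at hz
      clear h hb
      induction a with
      | nil => exact hz
      | cons c a ih => exact ih (cons_inj hz).2
    simp [hb, hu]
  rcases prepend_compare (h fun _ => false) with ⟨u, hu, -⟩ | ⟨u, hu, -⟩
  · exact key h hu
  · exact (key (fun z => (h z).symm) hu).symm

theorem exists_word (N : ℕ) (x : Cantor) : ∃ m : List Bool, m.length = N ∧ x ∈ sdi m := by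
  induction N generalizing x with
  | zero => exact ⟨[], rfl, x, rfl⟩
  | succ N ih =>
    obtain ⟨m, hm, z, hz⟩ := ih fun n => x (n + 1)
    refine ⟨x 0 :: m, by simp [hm], z, ?_⟩
    rw [prepend, hz, cons_head_tail]

theorem isOpen_sdi (m : List Bool) : IsOpen (sdi m) := by
  induction m with
  | nil =>
    have h : sdi [] = Set.univ := Set.range_eq_univ.2 fun x => ⟨x, rfl⟩
    rw [h]; exact isOpen_univ
  | cons b m ih =>
    have h : sdi (b :: m) =
        (fun x : Cantor => x 0) ⁻¹' {b} ∩ (fun (x : Cantor) (n : ℕ) => x (n + 1)) ⁻¹' sdi m := by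
      ext x
      constructor
      · rintro ⟨z, rfl⟩
        exact ⟨rfl, z, rfl⟩
      · rintro ⟨h0, z, hz⟩
        refine ⟨z, ?_⟩
        have h0' : x 0 = b := h0
        have hz' : prepend m z = fun n => x (n + 1) := hz
        rw [prepend, hz', ← h0', cons_head_tail]
    rw [h]
    exact ((isOpen_discrete _).preimage (continuous_apply 0)).inter
      (ih.preimage (continuous_pi fun n => continuous_apply (n + 1)))

theorem Adapted.append {v : Cantor → Cantor} {m w : List Bool} (h : Adapted v m w)
    (u : List Bool) : Adapted v (m ++ u) (w ++ u) := fun z => by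
  rw [prepend_append, prepend_append]; exact h _

/-- `v` is given by prefix replacements between two standard dyadic partitions. -/
def IsThompson (v : Cantor ≃ₜ Cantor) : Prop :=
  ∃ (n : ℕ) (p q : Fin n → List Bool), IsSdp p ∧ IsSdp q ∧ ∀ k, Adapted v (p k) (q k)

theorem isThompson_iff (v : Cantor ≃ₜ Cantor) :
    IsThompson v ↔ ∀ x : Cantor, ∃ m w, x ∈ sdi m ∧ Adapted v m w := by
  constructor
  · rintro ⟨n, p, q, hp, -, h⟩ x
    obtain ⟨k, hk, -⟩ := hp x
    exact ⟨p k, q k, hk, h k⟩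
  · intro h
    choose m w hm hw using h
    obtain ⟨t, ht⟩ := isCompact_univ.elim_finite_subcover (fun x => sdi (m x))
      (fun x => isOpen_sdi _) (fun x _ => Set.mem_iUnion.2 ⟨x, hm x⟩)
    let N : ℕ := t.sup fun x => (m x).length
    have key : ∀ r : List Bool, r.length = N → ∃ s, Adapted v r s := by
      intro r hr
      obtain ⟨i, hi, y, hy⟩ := Set.mem_iUnion₂.1 (ht (Set.mem_univ (prepend r fun _ => false)))
      have hlen : (m i).length ≤ r.length := by
        rw [hr]; exact Finset.le_sup (f := fun x => (m x).length) hi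
      have hpre : ∃ u, r = m i ++ u := by
        rcases prepend_compare hy with ⟨u, hu, -⟩ | ⟨u, hu, -⟩
        · exact ⟨u, hu⟩
        · rw [hu, List.length_append] at hlen
          have : u = [] := List.length_eq_zero_iff.1 (by omega)
          exact ⟨[], by simp [hu, this]⟩
      obtain ⟨u, rfl⟩ := hpre
      exact ⟨_, (hw i).append u⟩
    choose s hs using key
    obtain ⟨n, ⟨e⟩⟩ : ∃ n : ℕ, Nonempty (Fin n ≃ {r : List Bool // r.length = N}) :=
      ⟨_, ⟨(Fintype.equivFin (List.Vector Bool N)).symm⟩⟩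
    have hp : IsSdp fun k => (e k).1 := by
      intro x
      obtain ⟨r, hr, hx⟩ := exists_word N x
      refine ⟨e.symm ⟨r, hr⟩, by simpa using hx, fun k hk => ?_⟩
      apply e.injective
      apply Subtype.ext
      rw [Equiv.apply_symm_apply]
      obtain ⟨y, hy : prepend (e k).1 y = x⟩ := hk
      obtain ⟨z, hz⟩ := hx
      have h1 : (e k).1.length = N := (e k).2
      rcases prepend_compare (hy.trans hz.symm) with ⟨u, hu, -⟩ | ⟨u, hu, -⟩
      · have hl := congrArg List.length hu
        rw [List.length_append] at hl
        have : u = [] := List.length_eq_zero_iff.1 (by omega)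
        simp [hu, this]
      · have hl := congrArg List.length hu
        rw [List.length_append] at hl
        have : u = [] := List.length_eq_zero_iff.1 (by omega)
        simp [hu, this]
    refine ⟨_, fun k => (e k).1, fun k => s (e k).1 (e k).2, hp, ?_, fun k => hs _ _⟩
    intro y
    obtain ⟨k, ⟨z, hz⟩, hk'⟩ := hp (v.symm y)
    refine ⟨k, ⟨z, ?_⟩, ?_⟩
    · show prepend (s (e k).1 (e k).2) z = y
      rw [← hs _ (e k).2 z, hz, v.apply_symm_apply]
    · rintro j ⟨z', hz'⟩
      refine hk' j ⟨z', ?_⟩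
      show prepend (e j).1 z' = v.symm y
      rw [← hz', ← hs _ (e j).2 z', v.symm_apply_apply]

theorem Adapted.comp {v w : Cantor → Cantor} {x : Cantor}
    (hw : ∃ m r, x ∈ sdi m ∧ Adapted w m r) (hv : ∃ m r, w x ∈ sdi m ∧ Adapted v m r) :
    ∃ m r s, x ∈ sdi m ∧ Adapted w m r ∧ Adapted v r s := by
  obtain ⟨m, r, ⟨y, rfl⟩, hmr⟩ := hw
  obtain ⟨m', r', ⟨z, hz⟩, hmr'⟩ := hv
  rw [hmr y] at hz
  rcases prepend_compare hz with ⟨u, rfl, -⟩ | ⟨u, rfl, rfl⟩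
  · exact ⟨m, _, _, ⟨y, rfl⟩, hmr, hmr'.append u⟩
  · exact ⟨m ++ u, _, _, ⟨z, prepend_append _ _ _⟩, hmr.append u, hmr'⟩

end Cantor

open Cantor in
/-- Thompson's group `V` as a subgroup of the homeomorphism group of the Cantor space. -/
def ThompsonV : Subgroup (Cantor ≃ₜ Cantor) where
  carrier := {v | IsThompson v}
  one_mem' := (isThompson_iff 1).2 fun x => ⟨[], [], ⟨x, rfl⟩, fun _ => rfl⟩
  mul_mem' := by
    intro v w hv hw
    refine (isThompson_iff _).2 fun x => ?_
    obtain ⟨m, r, s, hx, h1, h2⟩ :=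
      Adapted.comp ((isThompson_iff w).1 hw x) ((isThompson_iff v).1 hv (w x))
    exact ⟨m, s, hx, fun z => by rw [Homeomorph.mul_apply, h1 z, h2 z]⟩
  inv_mem' := by
    rintro v ⟨n, p, q, hp, hq, h⟩
    exact ⟨n, q, p, hq, hp, fun k z => by rw [← h k z]; exact v.symm_apply_apply _⟩

namespace ThompsonV

open Cantor

theorem exists_adapted (v : ThompsonV) (x : Cantor) :
    ∃ mw : List Bool × List Bool, x ∈ sdi mw.1 ∧ Adapted v.1 mw.1 mw.2 := by
  obtain ⟨m, w, h⟩ := (isThompson_iff v.1).1 v.2 x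
  exact ⟨(m, w), h⟩

/-- `ad φ v = φ v φ⁻¹`, for `φ` in the normaliser of `V` in the homeomorphism group. -/
abbrev ad (φ : Subgroup.normalizer (ThompsonV : Set (Cantor ≃ₜ Cantor))) (v : ThompsonV) :
    ThompsonV :=
  ThompsonV.normalizerMonoidHom φ v

end ThompsonV

/-- The discrete loop group `LΓ` of locally constant maps from the Cantor space to `Γ`, with
pointwise multiplication. -/
abbrev LoopGroup (Γ : Type*) : Type _ := LocallyConstant Cantor Γ

section Twist

open Cantor

variable {Γ : Type*} [Group Γ] (α₀ α₁ : MulAut Γ)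

/-- For a word `m = l₁ ⋯ lₙ`, the automorphism `α_m = α_{lₙ} ∘ ⋯ ∘ α_{l₁}`. -/
def wordAut : List Bool → MulAut Γ
  | [] => 1
  | b :: m => wordAut m * (if b then α₁ else α₀)

theorem wordAut_append (m w : List Bool) :
    wordAut α₀ α₁ (m ++ w) = wordAut α₀ α₁ w * wordAut α₀ α₁ m := by
  induction m with
  | nil => simp [wordAut]
  | cons b m ih => simp [wordAut, ih, mul_assoc]

/-- The automorphism `τ_{v,x} = α_{v(I)}⁻¹ ∘ α_I`, where `I` is any standard dyadic interval
that contains `x` and is adapted to `v`; see `tau_eq` for the independence of `I`. -/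
noncomputable def tau (v : ThompsonV) (x : Cantor) : MulAut Γ :=
  (wordAut α₀ α₁ (ThompsonV.exists_adapted v x).choose.2)⁻¹ *
    wordAut α₀ α₁ (ThompsonV.exists_adapted v x).choose.1

theorem tau_eq (v : ThompsonV) {x : Cantor} {m w : List Bool} (hx : x ∈ sdi m)
    (h : Adapted v.1 m w) :
    tau α₀ α₁ v x = (wordAut α₀ α₁ w)⁻¹ * wordAut α₀ α₁ m := by
  have key : ∀ {m w m' w' : List Bool} (u : List Bool), Adapted v.1 m w → Adapted v.1 m' w' →
      m' = m ++ u → (wordAut α₀ α₁ w')⁻¹ * wordAut α₀ α₁ m' =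
        (wordAut α₀ α₁ w)⁻¹ * wordAut α₀ α₁ m := by
    rintro m w m' w' u h h' rfl
    have hw : w' = w ++ u := word_ext fun z => by rw [← h' z, ← h.append u z]
    rw [hw, wordAut_append, wordAut_append]
    group
  obtain ⟨h1, h2⟩ := (ThompsonV.exists_adapted v x).choose_spec
  obtain ⟨y, hy⟩ := h1
  obtain ⟨z, hz⟩ := hx
  unfold tau
  rcases prepend_compare (hy.trans hz.symm) with ⟨u, hu, -⟩ | ⟨u, hu, -⟩
  · exact (key u h2 h hu).symm
  · exact key u h h2 hu

theorem tau_one (x : Cantor) : tau α₀ α₁ 1 x = 1 := by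
  have h := tau_eq α₀ α₁ 1 (x := x) (m := []) (w := []) ⟨x, rfl⟩ fun _ => rfl
  rw [h]
  simp

theorem tau_mul (v w : ThompsonV) (x : Cantor) :
    tau α₀ α₁ (v * w) x = tau α₀ α₁ v (w.1 x) * tau α₀ α₁ w x := by
  obtain ⟨m, r, s, ⟨y, rfl⟩, h1, h2⟩ := Adapted.comp ((isThompson_iff w.1).1 w.2 x)
    ((isThompson_iff v.1).1 v.2 (w.1 x))
  rw [tau_eq α₀ α₁ (v * w) ⟨y, rfl⟩ (m := m) (w := s)
      fun z => by rw [← h2 z, ← h1 z]; rfl,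
    tau_eq α₀ α₁ w ⟨y, rfl⟩ h1, tau_eq α₀ α₁ v ⟨y, (h1 y).symm⟩ h2]
  group

theorem isLocallyConstant_tau (v : ThompsonV) : IsLocallyConstant (tau α₀ α₁ v) := by
  rw [IsLocallyConstant.iff_exists_open]
  intro x
  obtain ⟨⟨m, w⟩, hx, h⟩ := ThompsonV.exists_adapted v x
  exact ⟨sdi m, isOpen_sdi m, hx, fun y hy => by
    rw [tau_eq α₀ α₁ v hy h, tau_eq α₀ α₁ v hx h]⟩

/-- The map `π_v(a)`, determined by `π_v(a)(v x) = τ_{v,x}(a(x))`. -/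
noncomputable def jonesFun (v : ThompsonV) (a : LoopGroup Γ) : LoopGroup Γ where
  toFun y := tau α₀ α₁ v (v.1.symm y) (a (v.1.symm y))
  isLocallyConstant := by
    have h := ((isLocallyConstant_tau α₀ α₁ v).prodMk a.isLocallyConstant).comp
      fun p : MulAut Γ × Γ => p.1 p.2
    exact h.comp_continuous v.1.symm.continuous

theorem jonesFun_apply (v : ThompsonV) (a : LoopGroup Γ) (x : Cantor) :
    jonesFun α₀ α₁ v a (v.1 x) = tau α₀ α₁ v x (a x) := by
  show tau α₀ α₁ v (v.1.symm (v.1 x)) (a (v.1.symm (v.1 x))) = _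
  rw [v.1.symm_apply_apply]

theorem jonesFun_one (a : LoopGroup Γ) : jonesFun α₀ α₁ 1 a = a := by
  ext x
  have h := jonesFun_apply α₀ α₁ 1 a x
  rwa [tau_one] at h

theorem jonesFun_mul (v w : ThompsonV) (a : LoopGroup Γ) :
    jonesFun α₀ α₁ (v * w) a = jonesFun α₀ α₁ v (jonesFun α₀ α₁ w a) := by
  ext y
  obtain ⟨x, rfl⟩ := (v * w).1.surjective y
  rw [jonesFun_apply, tau_mul]
  show _ = jonesFun α₀ α₁ v (jonesFun α₀ α₁ w a) (v.1 (w.1 x))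
  rw [jonesFun_apply, jonesFun_apply]
  rfl

/-- The Jones action `π : V → Aut(LΓ)`. -/
noncomputable def jonesAction : ThompsonV →* MulAut (LoopGroup Γ) where
  toFun v :=
    { toFun := jonesFun α₀ α₁ v
      invFun := jonesFun α₀ α₁ v⁻¹
      left_inv := fun a => by rw [← jonesFun_mul, inv_mul_cancel, jonesFun_one]
      right_inv := fun a => by rw [← jonesFun_mul, mul_inv_cancel, jonesFun_one]
      map_mul' := fun a b => by
        ext y
        exact map_mul (tau α₀ α₁ v (v.1.symm y)) _ _ }
  map_one' := by
    ext a x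
    exact congrArg (fun b : LoopGroup Γ => b x) (jonesFun_one α₀ α₁ a)
  map_mul' v w := by
    ext a x
    exact congrArg (fun b : LoopGroup Γ => b x) (jonesFun_mul α₀ α₁ v w a)

/-- The twisted fraction group `LΓ ⋊ V` of the triple `(Γ, α₀, α₁)`. -/
abbrev FractionGroup : Type _ := LoopGroup Γ ⋊[jonesAction α₀ α₁] ThompsonV

end Twist

/-! The proof has three independent ingredients.

The loop group is seen by every surjection `ρ` of a fraction group onto `V` as trivial. Its image is
normal in `V`; if it were nontrivial it would contain many commutators and move points around
freely. Two loops supported on complementary halves commute, as do their brackets with arbitrary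
loops, yet the image would yield two such brackets acting at one point like non-commuting elements
of `V` (`map_inl_eq_one`). Applied to `θ` and its inverse, followed by the projections to `V`, this
splits `θ` into an isomorphism `κ` of loop groups, an automorphism `ψ` of `V` and a cocycle `c`,
with `κ` intertwining the Jones actions up to `ψ` and conjugation by `c`.

Automorphisms of `V` are spatial, by Rubin's method: inclusion of supports can be expressed by
commutation alone (`gsupp_subset_iff`), and points are recovered from the supports containing them.
This gives `φ`.

Finally, `κ` is local up to the centre. If `a` is trivial at `x`, then `κ a (φ x)` is central
(`apply_mem_center`). These central values on the trivial locus of `a` are compatible with the germs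
of `V`, and every `V`-orbit meets a nonempty open set, so they extend uniquely to an invariant
central loop. Assembling such loops over two halves gives a morphism `ζ` (`exists_central_part`).
Dividing `κ` by `ζ` leaves a map whose value at `φ x` depends only on `a x`. Its bijectivity, fibre
by fibre and globally, again comes from the invariance of `ζ` (`exists_spatial_part`). -/

open Topology
open scoped commutatorElement

/-! ### Dyadic intervals of the Cantor space -/

namespace Cantor

theorem prepend_injective (m : List Bool) : Function.Injective (prepend m) := by
  induction m with
  | nil => exact fun _ _ h => h
  | cons b m ih => exact fun _ _ h => ih (cons_inj h).2

theorem prepend_add_length (m : List Bool) (z : Cantor) (n : ℕ) :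
    prepend m z (n + m.length) = z n := by
  induction m with
  | nil => rfl
  | cons b m ih => exact ih

theorem prepend_apply_of_lt (m : List Bool) (z z' : Cantor) {n : ℕ} (h : n < m.length) :
    prepend m z n = prepend m z' n := by
  induction m generalizing n with
  | nil => simp at h
  | cons b m ih =>
    cases n with
    | zero => rfl
    | succ n => exact ih (by simpa using h)

theorem continuous_prepend (m : List Bool) : Continuous (prepend m) := by
  induction m with
  | nil => exact continuous_id
  | cons b m ih =>
    refine continuous_pi fun n => ?_
    cases n with
    | zero => exact continuous_const
    | succ n => exact (continuous_apply n).comp ih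

theorem prepend_mem_sdi (m : List Bool) (z : Cantor) : prepend m z ∈ sdi m := ⟨z, rfl⟩

theorem sdi_append_subset (m u : List Bool) : sdi (m ++ u) ⊆ sdi m := by
  rintro _ ⟨z, rfl⟩
  rw [prepend_append]
  exact prepend_mem_sdi _ _

theorem sdi_nonempty (m : List Bool) : (sdi m).Nonempty := ⟨_, prepend_mem_sdi m fun _ => false⟩

theorem disjoint_sdi_of_length_eq {m w : List Bool} (hl : m.length = w.length) (h : m ≠ w) :
    Disjoint (sdi m) (sdi w) := by
  rw [Set.disjoint_left]
  rintro _ ⟨y, rfl⟩ ⟨z, hz⟩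
  rcases prepend_compare hz with ⟨u, hu, -⟩ | ⟨u, hu, -⟩
  all_goals
    have hl' := congrArg List.length hu
    rw [List.length_append] at hl'
    have : u = [] := List.length_eq_zero_iff.1 (by omega)
    exact h (by simp [hu, this])

theorem disjoint_sdi_append (j : List Bool) {m w : List Bool} (h : Disjoint (sdi m) (sdi w)) :
    Disjoint (sdi (j ++ m)) (sdi (j ++ w)) := by
  rw [Set.disjoint_left] at *
  rintro _ ⟨y, rfl⟩ ⟨z, hz⟩
  rw [prepend_append, prepend_append] at hz
  exact h ⟨y, rfl⟩ ⟨z, prepend_injective j hz⟩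

theorem isCompact_sdi (m : List Bool) : IsCompact (sdi m) := isCompact_range (continuous_prepend m)

theorem isClopen_sdi (m : List Bool) : IsClopen (sdi m) :=
  ⟨(isCompact_sdi m).isClosed, isOpen_sdi m⟩

theorem sdi_bool_compl (b : Bool) : (sdi [b])ᶜ = sdi [!b] := by
  ext x
  constructor
  · intro hx
    refine ⟨fun n => x (n + 1), ?_⟩
    have h0 : x 0 = !b := by
      by_contra h
      rw [Bool.not_eq_not] at h
      exact hx ⟨fun n => x (n + 1), by rw [← h]; exact cons_head_tail x⟩
    rw [← h0]
    exact cons_head_tail x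
  · exact fun hx => Set.disjoint_right.1 (disjoint_sdi_of_length_eq (m := [b]) (w := [!b]) rfl (by simp)) hx

/-- Long words whose standard dyadic intervals are neighbourhoods of a point. -/
theorem exists_sdi_subset {U : Set Cantor} (hU : IsOpen U) {x : Cantor} (hx : x ∈ U) (k : ℕ) :
    ∃ m : List Bool, k ≤ m.length ∧ x ∈ sdi m ∧ sdi m ⊆ U := by
  obtain ⟨_, ⟨y, n, rfl⟩, hxy, hyU⟩ :=
    (PiNat.isTopologicalBasis_cylinders (fun _ : ℕ => Bool)).exists_subset_of_mem_open hx hU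
  obtain ⟨m, hm, z, rfl⟩ := exists_word (max n k) x
  refine ⟨m, by omega, ⟨z, rfl⟩, ?_⟩
  rintro _ ⟨z', rfl⟩
  refine hyU fun i hi => ?_
  rw [prepend_apply_of_lt m z' z (by omega)]
  exact hxy i hi

theorem exists_sdi_subset_of_mem_nhds {U : Set Cantor} {x : Cantor} (hU : U ∈ 𝓝 x) (k : ℕ) :
    ∃ m : List Bool, k ≤ m.length ∧ x ∈ sdi m ∧ sdi m ⊆ U := by
  obtain ⟨m, hm, hx, h⟩ := exists_sdi_subset isOpen_interior (mem_interior_iff_mem_nhds.2 hU) k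
  exact ⟨m, hm, hx, h.trans interior_subset⟩

theorem sdi_mem_nhds {m : List Bool} {x : Cantor} (h : x ∈ sdi m) : sdi m ∈ 𝓝 x :=
  (isOpen_sdi m).mem_nhds h

theorem continuous_of_adapted {f : Cantor → Cantor}
    (hf : ∀ x, ∃ m w, x ∈ sdi m ∧ Adapted f m w) : Continuous f := by
  rw [continuous_iff_continuousAt]
  intro x
  obtain ⟨m, w, hx, h⟩ := hf x
  have hc : Continuous fun y : Cantor => prepend w fun n => y (n + m.length) :=
    (continuous_prepend w).comp (continuous_pi fun n => continuous_apply _)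
  refine hc.continuousAt.congr ?_
  filter_upwards [sdi_mem_nhds hx]
  rintro _ ⟨z, rfl⟩
  rw [h z]
  congr 1
  funext n
  exact prepend_add_length m z n

end Cantor

/-! ### The action of `V`: swaps and transitivity -/

namespace ThompsonV

open Cantor

instance : MulAction ThompsonV Cantor where
  smul v x := v.1 x
  one_smul _ := rfl
  mul_smul _ _ _ := rfl

instance : FaithfulSMul ThompsonV Cantor :=
  ⟨fun h => Subtype.ext (Homeomorph.ext h)⟩

instance : ContinuousConstSMul ThompsonV Cantor := ⟨fun v => v.1.continuous⟩

theorem exists_adapted_smul (v : ThompsonV) (x : Cantor) :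
    ∃ m w : List Bool, x ∈ sdi m ∧ ∀ z, v • prepend m z = prepend w z := by
  obtain ⟨⟨m, w⟩, h⟩ := exists_adapted v x
  exact ⟨m, w, h⟩

open Classical in
/-- The swap of two disjoint standard dyadic intervals. -/
theorem exists_swap {a b : List Bool} (hab : Disjoint (sdi a) (sdi b)) :
    ∃ s : ThompsonV, (∀ z, s • prepend a z = prepend b z) ∧ (∀ z, s • prepend b z = prepend a z) ∧
      (∀ x, x ∉ sdi a ∪ sdi b → s • x = x) ∧ s⁻¹ = s := by
  let f : Cantor → Cantor := fun x =>
    if h : x ∈ sdi a then prepend b h.choose else if h : x ∈ sdi b then prepend a h.choose else x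
  have fa : ∀ z, f (prepend a z) = prepend b z := by
    intro z
    have h : prepend a z ∈ sdi a := ⟨z, rfl⟩
    simp only [f, dif_pos h]
    rw [prepend_injective a h.choose_spec]
  have fb : ∀ z, f (prepend b z) = prepend a z := by
    intro z
    have h : prepend b z ∈ sdi b := ⟨z, rfl⟩
    simp only [f, dif_pos h, dif_neg (Set.disjoint_right.1 hab h)]
    rw [prepend_injective b h.choose_spec]
  have fc : ∀ x, x ∉ sdi a ∪ sdi b → f x = x := by
    intro x hx
    rw [Set.mem_union, not_or] at hx
    simp only [f, dif_neg hx.1, dif_neg hx.2]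
  have hf : ∀ x, f (f x) = x := by
    intro x
    by_cases h : x ∈ sdi a ∪ sdi b
    · rcases h with ⟨z, rfl⟩ | ⟨z, rfl⟩
      · rw [fa, fb]
      · rw [fb, fa]
    · rw [fc x h, fc x h]
  have hloc : ∀ x, ∃ m w, x ∈ sdi m ∧ Adapted f m w := by
    intro x
    by_cases h : x ∈ sdi a ∪ sdi b
    · rcases h with h | h
      · exact ⟨a, b, h, fa⟩
      · exact ⟨b, a, h, fb⟩
    · obtain ⟨m, -, hx, hm⟩ := exists_sdi_subset
        ((isClopen_sdi a).union (isClopen_sdi b)).compl.isOpen h 0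
      exact ⟨m, m, hx, fun z => fc _ (hm ⟨z, rfl⟩)⟩
  let e : Cantor ≃ₜ Cantor :=
    ⟨⟨f, f, hf, hf⟩, continuous_of_adapted hloc, continuous_of_adapted hloc⟩
  exact ⟨⟨e, (isThompson_iff e).2 hloc⟩, fa, fb, fc, rfl⟩

/-- `V` acts transitively on the proper standard dyadic intervals. -/
theorem exists_adapted_of_ne_nil {a b : List Bool} (ha : a ≠ []) (hb : b ≠ []) :
    ∃ v : ThompsonV, ∀ z, v • prepend a z = prepend b z := by
  obtain ⟨p, a, rfl⟩ := List.exists_cons_of_ne_nil ha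
  obtain ⟨q, b, rfl⟩ := List.exists_cons_of_ne_nil hb
  -- An interval inside one half is disjoint from the opposite half, so a single swap carries it
  -- onto that half. General intervals are then connected through halves.
  have key : ∀ (r : Bool) (m : List Bool), ∃ v : ThompsonV, ∀ z,
      v • prepend (r :: m) z = prepend [!r] z := by
    intro r m
    obtain ⟨s, hs, -⟩ := exists_swap (a := r :: m) (b := [!r]) <|
      (disjoint_sdi_of_length_eq (m := [r]) (w := [!r]) rfl (by simp)).mono_left (sdi_append_subset [r] m)
    exact ⟨s, hs⟩
  obtain ⟨v, hv⟩ := key p a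
  obtain ⟨w, hw⟩ := key q b
  have hw' : ∀ z, w⁻¹ • prepend [!q] z = prepend (q :: b) z := fun z => by
    rw [← hw, inv_smul_smul]
  obtain ⟨s, hs⟩ : ∃ s : ThompsonV, ∀ z, s • prepend [!p] z = prepend [!q] z := by
    by_cases h : p = q
    · exact ⟨1, fun z => by rw [h, one_smul]⟩
    · obtain ⟨s, hs, -⟩ := exists_swap (a := [!p]) (b := [!q]) <|
        disjoint_sdi_of_length_eq rfl (by simpa using h)
      exact ⟨s, hs⟩
  exact ⟨w⁻¹ * s * v, fun z => by rw [mul_smul, mul_smul, hv, hs, hw']⟩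

/-- The orbits of `V` meet every nonempty open set. -/
theorem exists_smul_mem {U : Set Cantor} (hU : IsOpen U) (hne : U.Nonempty) (x : Cantor) :
    ∃ v : ThompsonV, v • x ∈ U := by
  obtain ⟨y, hy⟩ := hne
  obtain ⟨m, hm, -, hmU⟩ := exists_sdi_subset hU hy 1
  obtain ⟨w, hw, z, rfl⟩ := exists_word 1 x
  obtain ⟨v, hv⟩ := exists_adapted_of_ne_nil (a := w) (b := m)
    (by rintro rfl; simp at hw) (by rintro rfl; simp at hm)
  exact ⟨v, hmU ⟨z, (hv z).symm⟩⟩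

end ThompsonV

/-! ### Supports and displacement commutators -/

section SuppIn

variable {G X : Type*} [Group G] [MulAction G X]

/-- `g` fixes every point outside `A`. -/
def SuppIn (A : Set X) (g : G) : Prop := ∀ x, x ∉ A → g • x = x

theorem SuppIn.mono {A B : Set X} {g : G} (h : SuppIn A g) (hAB : A ⊆ B) : SuppIn B g :=
  fun x hx => h x fun hA => hx (hAB hA)

theorem SuppIn.inv {A : Set X} {g : G} (h : SuppIn A g) : SuppIn A g⁻¹ :=
  fun x hx => inv_smul_eq_iff.2 (h x hx).symm

theorem SuppIn.mul {A : Set X} {g k : G} (hg : SuppIn A g) (hk : SuppIn A k) :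
    SuppIn A (g * k) :=
  fun x hx => by rw [mul_smul, hk x hx, hg x hx]

theorem SuppIn.pow {A : Set X} {g : G} (hg : SuppIn A g) (n : ℕ) : SuppIn A (g ^ n) := by
  induction n with
  | zero => exact fun x _ => by rw [pow_zero, one_smul]
  | succ n ih => rw [pow_succ]; exact ih.mul hg

theorem SuppIn.commutator {A : Set X} {g k : G} (hg : SuppIn A g) (hk : SuppIn A k) :
    SuppIn A ⁅g, k⁆ :=
  ((hg.mul hk).mul hg.inv).mul hk.inv

theorem SuppIn.smul_mem {A : Set X} {g : G} (h : SuppIn A g) {x : X} (hx : x ∈ A) :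
    g • x ∈ A := by
  by_contra hn
  have h' := h.inv _ hn
  rw [inv_smul_smul] at h'
  exact hn (h' ▸ hx)

open Pointwise in
theorem SuppIn.conj {A : Set X} {g : G} (h : SuppIn A g) (k : G) :
    SuppIn (k • A) (k * g * k⁻¹) := fun x hx => by
  rw [mul_smul, mul_smul, h (k⁻¹ • x) (fun h => hx (Set.mem_smul_set_iff_inv_smul_mem.2 h)),
    smul_inv_smul]

theorem SuppIn.commute [FaithfulSMul G X] {A B : Set X} (hAB : Disjoint A B) {g k : G}
    (hg : SuppIn A g) (hk : SuppIn B k) : Commute g k := by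
  refine eq_of_smul_eq_smul (α := X) fun x => ?_
  rw [mul_smul, mul_smul]
  by_cases hA : x ∈ A
  · rw [hk _ (Set.disjoint_left.1 hAB hA), hk _ (Set.disjoint_left.1 hAB (hg.smul_mem hA))]
  · rw [hg x hA]
    by_cases hB : x ∈ B
    · rw [hg _ (Set.disjoint_right.1 hAB (hk.smul_mem hB))]
    · rw [hk x hB, hg x hA]

open Pointwise

theorem commutator_eq_mul_conj (f u : G) : ⁅f, u⁆ = f * (u * f⁻¹ * u⁻¹) := by
  rw [commutatorElement_def]; group

theorem commutator_mul_right_of_commute {f g k : G} (hf : Commute k f) :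
    ⁅f, g * k⁆ = ⁅f, g⁆ := by
  have h := hf.inv_right.eq
  calc ⁅f, g * k⁆ = f * g * (k * f⁻¹) * k⁻¹ * g⁻¹ := by rw [commutatorElement_def]; group
    _ = ⁅f, g⁆ := by rw [h, commutatorElement_def]; group

/-- If `u` displaces `J` then bracketing with `u` does not change commutators of elements
supported in `J`. -/
theorem commutator_commutator_of_displaced [FaithfulSMul G X] {J : Set X} {f g u : G} (hf : SuppIn J f)
    (hg : SuppIn J g) (hu : Disjoint J (u • J)) : ⁅f, ⁅g, u⁆⁆ = ⁅f, g⁆ := by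
  -- The bracket is `g` times a conjugate of `g⁻¹` living on `u • J`; that second factor commutes
  -- with `f`.
  rw [commutator_eq_mul_conj g u]
  exact commutator_mul_right_of_commute (SuppIn.commute hu hf (hg.inv.conj u)).symm

/-- The second factor of `f * (u * f⁻¹ * u⁻¹)` lives on `u • J` and so is invisible on `J`. -/
theorem commutator_smul_of_displaced {J : Set X} {f u : G} (hf : SuppIn J f)
    (hu : Disjoint J (u • J)) {x : X} (hx : x ∈ J) : ⁅f, u⁆ • x = f • x := by
  rw [commutator_eq_mul_conj, mul_smul, hf.inv.conj u x (Set.disjoint_left.1 hu hx)]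

end SuppIn

namespace ThompsonV

open Cantor Pointwise

theorem exists_displaced_nhds {v : ThompsonV} {x : Cantor} (h : v • x ≠ x) :
    ∃ U : Set Cantor, IsOpen U ∧ x ∈ U ∧ Disjoint U (v • U) := by
  obtain ⟨A, B, hA, hB, hxA, hxB, hAB⟩ := t2_separation h
  refine ⟨B ∩ v⁻¹ • A, hB.inter (hA.smul _), ⟨hxB, ?_⟩, ?_⟩
  · rw [Set.mem_inv_smul_set_iff]; exact hxA
  · refine (hAB.symm.mono_left Set.inter_subset_left).mono_right ?_
    rw [Set.smul_set_inter, smul_inv_smul]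
    exact Set.inter_subset_right

theorem disjoint_smul_mono {v : ThompsonV} {A B : Set Cantor} (h : Disjoint B (v • B))
    (hAB : A ⊆ B) : Disjoint A (v • A) :=
  h.mono hAB (Set.smul_set_mono hAB)

theorem exists_smul_ne {v : ThompsonV} (h : v ≠ 1) : ∃ x : Cantor, v • x ≠ x := by
  by_contra! hc
  exact h (eq_of_smul_eq_smul (α := Cantor) fun x => by rw [hc, one_smul])

theorem isOpen_setOf_smul_ne (v : ThompsonV) : IsOpen {x : Cantor | v • x ≠ x} :=
  isOpen_ne_fun (continuous_const_smul v) continuous_id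

end ThompsonV

/-! ### Normal subgroups of `V` -/

namespace ThompsonV

open Cantor Pointwise

theorem smul_sdi {v : ThompsonV} {a b : List Bool} (h : ∀ z, v • prepend a z = prepend b z) :
    v • sdi a = sdi b := by
  ext x
  constructor
  · rintro ⟨_, ⟨z, rfl⟩, rfl⟩
    exact ⟨z, (h z).symm⟩
  · rintro ⟨z, rfl⟩
    exact ⟨_, ⟨z, rfl⟩, h z⟩

theorem commutator_mem_of_left {G : Type*} [Group G] {M : Subgroup G} [M.Normal] (f : G) {u : G}
    (hu : u ∈ M) : ⁅f, u⁆ ∈ M :=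
  M.mul_mem (Subgroup.Normal.conj_mem inferInstance u hu f) (M.inv_mem hu)

/-- A nontrivial normal subgroup of `V` contains the commutators of elements that act trivially
on a common standard dyadic interval. -/
theorem commutator_mem_of_normal {M : Subgroup ThompsonV} [M.Normal] {u : ThompsonV} (hu : u ∈ M)
    (hu1 : u ≠ 1) {z : List Bool} (hz : z ≠ []) {f g : ThompsonV} (hf : SuppIn (sdi z)ᶜ f)
    (hg : SuppIn (sdi z)ᶜ g) : ⁅f, g⁆ ∈ M := by
  obtain ⟨x, hx⟩ := exists_smul_ne hu1
  obtain ⟨U, hU, hxU, hdisj⟩ := exists_displaced_nhds hx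
  obtain ⟨j, hj, -, hjU⟩ := exists_sdi_subset hU hxU 1
  have hj' : j ≠ [] := by rintro rfl; simp at hj
  obtain ⟨p, hp⟩ := exists_adapted_of_ne_nil (a := [false]) (b := j) (by simp) hj'
  obtain ⟨q, hq⟩ := exists_adapted_of_ne_nil (a := z) (b := [true]) hz (by simp)
  -- `q` sends the interval of `z` to the right half, hence its complement to the left half, which
  -- `p` shrinks into the set displaced by `u`.
  have hv : (p * q) • (sdi z)ᶜ = sdi j := by
    rw [mul_smul, Set.smul_set_compl, smul_sdi hq, sdi_bool_compl, Bool.not_true, smul_sdi hp]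
  have hf' := hf.conj (p * q)
  have hg' := hg.conj (p * q)
  rw [hv] at hf' hg'
  have h := commutator_commutator_of_displaced hf' hg' (disjoint_smul_mono hdisj hjU)
  have hM : ⁅p * q * f * (p * q)⁻¹, p * q * g * (p * q)⁻¹⁆ ∈ M := by
    rw [← h]
    exact commutator_mem_of_left _ (commutator_mem_of_left _ hu)
  rw [← conjugate_commutatorElement] at hM
  have := Subgroup.Normal.conj_mem (inferInstance : M.Normal) _ hM (p * q)⁻¹
  convert this using 1
  group

/-- Commutators of swaps that permute three disjoint standard dyadic intervals cyclically. -/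
theorem exists_threeCycle {a b c : List Bool} (hab : Disjoint (sdi a) (sdi b))
    (hbc : Disjoint (sdi b) (sdi c)) (hac : Disjoint (sdi a) (sdi c)) :
    ∃ s t : ThompsonV, SuppIn (sdi a ∪ sdi b ∪ sdi c) s ∧ SuppIn (sdi a ∪ sdi b ∪ sdi c) t ∧
      (∀ z, ⁅s, t⁆ • prepend c z = prepend b z) ∧ (∀ z, ⁅s, t⁆ • prepend b z = prepend a z) ∧
      ∀ z, ⁅s, t⁆ • prepend a z = prepend c z := by
  obtain ⟨s, sa, sb, sc, hs⟩ := exists_swap hab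
  obtain ⟨t, tb, tc, ta, ht⟩ := exists_swap hbc
  have sc' : ∀ z, s • prepend c z = prepend c z := fun z => sc _ <| by
    rintro (h | h)
    · exact Set.disjoint_right.1 hac ⟨z, rfl⟩ h
    · exact Set.disjoint_right.1 hbc ⟨z, rfl⟩ h
  have ta' : ∀ z, t • prepend a z = prepend a z := fun z => ta _ <| by
    rintro (h | h)
    · exact Set.disjoint_left.1 hab ⟨z, rfl⟩ h
    · exact Set.disjoint_left.1 hac ⟨z, rfl⟩ h
  have h : ∀ x : Cantor, ⁅s, t⁆ • x = s • t • s • t • x := fun x => by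
    rw [commutatorElement_def, hs, ht]; simp only [mul_smul]
  have hS : SuppIn (sdi a ∪ sdi b) s := sc
  have hT : SuppIn (sdi b ∪ sdi c) t := ta
  refine ⟨s, t, hS.mono Set.subset_union_left, hT.mono ?_, ?_, ?_, ?_⟩
  · exact Set.union_subset_union_left _ Set.subset_union_right
  · intro z; rw [h, tc, sb, ta', sa]
  · intro z; rw [h, tb, sc', tc, sb]
  · intro z; rw [h, ta', sa, tb, sc']

/-- Nontrivial normal subgroups of `V` act topologically transitively. -/
theorem exists_mem_normal_smul_mem {M : Subgroup ThompsonV} [M.Normal] {u : ThompsonV}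
    (hu : u ∈ M) (hu1 : u ≠ 1) {U W : Set Cantor} (hU : IsOpen U) (hW : IsOpen W)
    (hUne : U.Nonempty) (hWne : W.Nonempty) : ∃ m ∈ M, ∃ x ∈ U, m • x ∈ W := by
  by_cases hUW : Disjoint U W
  · obtain ⟨x, hx⟩ := hUne
    obtain ⟨y, hy⟩ := hWne
    obtain ⟨c, -, -, hc⟩ := exists_sdi_subset hU hx 0
    obtain ⟨b, -, -, hb⟩ := exists_sdi_subset hW hy 0
    have hft : ∀ m : List Bool, Disjoint (sdi (m ++ [true])) (sdi (m ++ [false])) := fun m =>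
      disjoint_sdi_append m (disjoint_sdi_of_length_eq rfl (by simp))
    have hcb : ∀ p q, Disjoint (sdi (c ++ p)) (sdi (b ++ q)) := fun p q =>
      hUW.mono ((sdi_append_subset _ _).trans hc) ((sdi_append_subset _ _).trans hb)
    -- The cycle uses two pieces of `U` and one of `W`. Both swaps fix the other half of the
    -- interval of `b`, which is what puts their commutator in `M`.
    obtain ⟨s, t, hs, ht, hst, -⟩ := exists_threeCycle (a := c ++ [true]) (b := b ++ [false])
      (c := c ++ [false]) (hcb _ _) (hcb _ _).symm (hft c)
    have hsub : sdi (c ++ [true]) ∪ sdi (b ++ [false]) ∪ sdi (c ++ [false]) ⊆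
        (sdi (b ++ [true]))ᶜ := by
      refine Disjoint.subset_compl_right ?_
      rw [Set.disjoint_union_left, Set.disjoint_union_left]
      exact ⟨⟨hcb _ _, (hft b).symm⟩, hcb _ _⟩
    refine ⟨⁅s, t⁆, commutator_mem_of_normal hu hu1 (by simp) (hs.mono hsub) (ht.mono hsub),
      prepend (c ++ [false]) x, hc (sdi_append_subset _ _ ⟨x, rfl⟩), ?_⟩
    rw [hst]
    exact hb (sdi_append_subset _ _ ⟨x, rfl⟩)
  · obtain ⟨x, hx, hx'⟩ := Set.not_disjoint_iff.1 hUW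
    exact ⟨1, M.one_mem, x, hx, by rwa [one_smul]⟩

/-- Commutators supported in a given standard dyadic interval which do not commute there. -/
theorem exists_commutators_not_commute (j : List Bool) :
    ∃ f₁ f₂ g₁ g₂ : ThompsonV, SuppIn (sdi j) f₁ ∧ SuppIn (sdi j) f₂ ∧ SuppIn (sdi j) g₁ ∧
      SuppIn (sdi j) g₂ ∧ ∃ x ∈ sdi j, ⁅f₁, f₂⁆ • ⁅g₁, g₂⁆ • x ≠ ⁅g₁, g₂⁆ • ⁅f₁, f₂⁆ • x := by
  have hd : ∀ {m w : List Bool}, m.length = w.length → m ≠ w →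
      Disjoint (sdi (j ++ m)) (sdi (j ++ w)) := fun hl hne =>
    disjoint_sdi_append j (disjoint_sdi_of_length_eq hl hne)
  have hsub : ∀ a b c : List Bool, sdi (j ++ a) ∪ sdi (j ++ b) ∪ sdi (j ++ c) ⊆ sdi j :=
    fun a b c => Set.union_subset (Set.union_subset (sdi_append_subset _ _)
      (sdi_append_subset _ _)) (sdi_append_subset _ _)
  -- Two 3-cycles of quarters of the interval sharing 00 and 01, with third quarter 10 and 11
  -- respectively. On the quarter 01 the two orders of composition end in 10 and in 11.
  obtain ⟨f₁, f₂, hf₁, hf₂, -, hfb, hfa⟩ := exists_threeCycle (a := j ++ [false, false])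
    (b := j ++ [false, true]) (c := j ++ [true, false]) (hd rfl (by simp)) (hd rfl (by simp))
    (hd rfl (by simp))
  obtain ⟨g₁, g₂, hg₁, hg₂, -, hgb, hga⟩ := exists_threeCycle (a := j ++ [false, false])
    (b := j ++ [false, true]) (c := j ++ [true, true]) (hd rfl (by simp)) (hd rfl (by simp))
    (hd rfl (by simp))
  refine ⟨f₁, f₂, g₁, g₂, hf₁.mono (hsub _ _ _), hf₂.mono (hsub _ _ _), hg₁.mono (hsub _ _ _),
    hg₂.mono (hsub _ _ _), prepend (j ++ [false, true]) fun _ => false,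
    sdi_append_subset _ _ ⟨_, rfl⟩, ?_⟩
  rw [hgb, hfa, hfb, hga]
  intro h
  exact Set.disjoint_left.1 (hd (m := [true, false]) (w := [true, true]) rfl (by simp))
    ⟨_, rfl⟩ ⟨_, h.symm⟩

end ThompsonV

/-! ### Surjections onto `V` kill the loop group -/

section Twist

open Cantor Pointwise

variable {Γ : Type*} [Group Γ] (α₀ α₁ : MulAut Γ)

theorem jonesAction_smul (v : ThompsonV) (a : LoopGroup Γ) (x : Cantor) :
    jonesAction α₀ α₁ v a (v • x) = tau α₀ α₁ v x (a x) :=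
  jonesFun_apply α₀ α₁ v a x

theorem jonesAction_apply (v : ThompsonV) (a : LoopGroup Γ) (y : Cantor) :
    jonesAction α₀ α₁ v a y = tau α₀ α₁ v (v⁻¹ • y) (a (v⁻¹ • y)) :=
  rfl

theorem loopGroup_commute_of_disjoint {Γ : Type*} [Group Γ] {A B : Set Cantor}
    (hAB : Disjoint A B) {a b : LoopGroup Γ} (ha : ∀ x, x ∉ A → a x = 1)
    (hb : ∀ x, x ∉ B → b x = 1) : Commute a b := by
  refine LocallyConstant.ext fun x => ?_
  rw [LocallyConstant.mul_apply, LocallyConstant.mul_apply]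
  by_cases hx : x ∈ A
  · rw [hb x (Set.disjoint_left.1 hAB hx), mul_one, one_mul]
  · rw [ha x hx, mul_one, one_mul]

theorem loopGroup_conj_eq_one {Γ : Type*} [Group Γ] {a : LoopGroup Γ} {x : Cantor}
    (ha : a x = 1) (c : LoopGroup Γ) : (c * a * c⁻¹) x = 1 := by
  rw [LocallyConstant.mul_apply, LocallyConstant.mul_apply, LocallyConstant.inv_apply, ha]
  simp

theorem mulIndicator_mul_mulIndicator_compl {Γ : Type*} [Group Γ] (a : LoopGroup Γ)
    {U : Set Cantor} (hU : IsClopen U) :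
    a.mulIndicator hU * a.mulIndicator hU.compl = a := by
  refine LocallyConstant.ext fun x => ?_
  rw [LocallyConstant.mul_apply]
  by_cases hx : x ∈ U
  · rw [LocallyConstant.mulIndicator_of_mem _ _ hx,
      LocallyConstant.mulIndicator_of_notMem _ hU.compl (fun h => h hx), mul_one]
  · rw [LocallyConstant.mulIndicator_of_notMem _ _ hx,
      LocallyConstant.mulIndicator_of_mem _ hU.compl hx, one_mul]

open ThompsonV SemidirectProduct

/-- If the image were nontrivial, loops on opposite halves, which commute, could be arranged to have
images moving a common point. Bracketing them with lifts of non-commuting elements supported near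
that point contradicts commutation. -/
theorem map_inl_eq_one_of_forall_notMem_half (ρ : FractionGroup α₀ α₁ →* ThompsonV)
    (hρ : Function.Surjective ρ) (b : Bool) {a : LoopGroup Γ} (ha : ∀ x, x ∉ sdi [b] → a x = 1) :
    ρ (inl a) = 1 := by
  by_contra hu1
  let M : Subgroup ThompsonV := (rightHom : FractionGroup α₀ α₁ →* ThompsonV).ker.map ρ
  have : M.Normal := Subgroup.Normal.map inferInstance ρ hρ
  have hM : ∀ m, m ∈ M ↔ ∃ d, ρ (inl d) = m := by
    intro m
    constructor
    · rintro ⟨g, hg, rfl⟩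
      rw [← range_inl_eq_ker_rightHom] at hg
      obtain ⟨d, rfl⟩ := hg
      exact ⟨d, rfl⟩
    · rintro ⟨d, rfl⟩
      exact ⟨_, rightHom_inl d, rfl⟩
  have huM : ρ (inl a) ∈ M := (hM _).2 ⟨a, rfl⟩
  obtain ⟨s, hs, hs', -, -⟩ := exists_swap (a := [b]) (b := [!b])
    (disjoint_sdi_of_length_eq rfl (by simp))
  let a' := jonesAction α₀ α₁ s a
  have ha' : ∀ x, x ∉ sdi [!b] → a' x = 1 := by
    intro x hx
    rw [jonesAction_apply, ha, map_one]
    rintro ⟨z, hz⟩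
    exact hx ⟨z, by rw [← hs, hz, smul_inv_smul]⟩
  have hu' : ρ (inl a') ≠ 1 := by
    rw [inl_aut, map_mul, map_mul, map_inv, map_inv]
    simpa using hu1
  -- Topological transitivity of `M` allows conjugating by a loop `d` so that the images of `d * a *
  -- d⁻¹` and `a'` move the same point. Conjugation by a loop is pointwise, so it keeps the support
  -- of `a` in its half.
  obtain ⟨m, hm, x, hx, hmx⟩ := exists_mem_normal_smul_mem huM hu1
    (isOpen_setOf_smul_ne (ρ (inl a))) (isOpen_setOf_smul_ne (ρ (inl a')))
    (exists_smul_ne hu1) (exists_smul_ne hu')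
  obtain ⟨d, rfl⟩ := (hM m).1 hm
  have hx2 : ρ (inl (d * a * d⁻¹)) • ρ (inl d) • x ≠ ρ (inl d) • x := by
    intro h
    apply hx
    rw [map_mul, map_mul, map_mul, map_mul, map_inv, map_inv, mul_smul, mul_smul,
      inv_smul_smul] at h
    exact smul_left_cancel _ h
  obtain ⟨U, hU, hxU, hUd⟩ := exists_displaced_nhds hx2
  obtain ⟨U', hU', hxU', hUd'⟩ := exists_displaced_nhds hmx
  obtain ⟨j, hj, -, hjU⟩ := exists_sdi_subset (hU.inter hU') ⟨hxU, hxU'⟩ 1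
  obtain ⟨f₁, f₂, g₁, g₂, hf₁, hf₂, hg₁, hg₂, y, hy, hne⟩ := exists_commutators_not_commute j
  obtain ⟨c, j, rfl⟩ := List.exists_cons_of_ne_nil (l := j) (by rintro rfl; simp at hj)
  have hsub : sdi (c :: j) ⊆ (sdi [!c])ᶜ := by
    rw [sdi_bool_compl, Bool.not_not]
    exact sdi_append_subset [c] j
  -- These commutators belong to `M`, so they lift to loops; brackets of the lifts with `d * a *
  -- d⁻¹` and `a'` remain on opposite halves.
  obtain ⟨e₁, he₁⟩ := (hM _).1 (commutator_mem_of_normal huM hu1 (by simp) (hf₁.mono hsub)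
    (hf₂.mono hsub))
  obtain ⟨e₂, he₂⟩ := (hM _).1 (commutator_mem_of_normal huM hu1 (by simp) (hg₁.mono hsub)
    (hg₂.mono hsub))
  have hf := hf₁.commutator hf₂
  have hg := hg₁.commutator hg₂
  set f := ⁅f₁, f₂⁆
  set g := ⁅g₁, g₂⁆
  have hcomm : Commute ⁅f, ρ (inl (d * a * d⁻¹))⁆ ⁅g, ρ (inl a')⁆ := by
    rw [← he₁, ← he₂, ← map_commutatorElement, ← map_commutatorElement, ← map_commutatorElement,
      ← map_commutatorElement]
    refine Commute.map (Commute.map (loopGroup_commute_of_disjoint (A := sdi [b]) (B := sdi [!b])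
      (disjoint_sdi_of_length_eq rfl (by simp)) ?_ ?_) _) _
    · intro x hx
      have h := loopGroup_conj_eq_one (ha x hx) d
      rw [commutatorElement_def, LocallyConstant.mul_apply, LocallyConstant.inv_apply, h,
        loopGroup_conj_eq_one h]
      simp
    · intro x hx
      rw [commutatorElement_def, LocallyConstant.mul_apply, LocallyConstant.inv_apply, ha' x hx,
        loopGroup_conj_eq_one (ha' x hx)]
      simp
  apply hne
  have h := congrArg (· • y) hcomm.eq
  simp only [mul_smul] at h
  -- Both images displace the interval, so the commuting brackets act on it exactly as `f` and `g`.
  have d₁ := disjoint_smul_mono hUd (hjU.trans Set.inter_subset_left)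
  have d₂ := disjoint_smul_mono hUd' (hjU.trans Set.inter_subset_right)
  rwa [commutator_smul_of_displaced hg d₂ hy, commutator_smul_of_displaced hf d₁ hy,
    commutator_smul_of_displaced hf d₁ (hg.smul_mem hy),
    commutator_smul_of_displaced hg d₂ (hf.smul_mem hy)] at h

/-- Every surjection of a fraction group onto `V` is trivial on the loop group. -/
theorem map_inl_eq_one (ρ : FractionGroup α₀ α₁ →* ThompsonV) (hρ : Function.Surjective ρ)
    (a : LoopGroup Γ) : ρ (inl a) = 1 := by
  rw [← mulIndicator_mul_mulIndicator_compl a (isClopen_sdi [false]), map_mul, map_mul,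
    map_inl_eq_one_of_forall_notMem_half α₀ α₁ ρ hρ false
      (fun x hx => LocallyConstant.mulIndicator_of_notMem _ _ hx),
    map_inl_eq_one_of_forall_notMem_half α₀ α₁ ρ hρ true, one_mul]
  intro x hx
  refine LocallyConstant.mulIndicator_of_notMem _ _ ?_
  rwa [sdi_bool_compl]

end Twist

/-! ### Rubin's reconstruction: automorphisms of `V` are spatial -/

/-- The algebraic disjointness relation of Rubin. -/
def AlgDisjoint {G : Type*} [Group G] (f g : G) : Prop :=
  ∀ h, ¬ Commute f h → ∃ f₁ f₂ : G, Commute f₁ g ∧ Commute f₂ g ∧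
    ⁅f₁, ⁅f₂, h⁆⁆ ≠ 1 ∧ Commute ⁅f₁, ⁅f₂, h⁆⁆ g

theorem AlgDisjoint.map {G H : Type*} [Group G] [Group H] (ψ : G ≃* H) {f g : G}
    (h : AlgDisjoint f g) : AlgDisjoint (ψ f) (ψ g) := by
  intro k hk
  obtain ⟨k, rfl⟩ := ψ.surjective k
  obtain ⟨f₁, f₂, h₁, h₂, h₃, h₄⟩ := h k (fun hc => hk (hc.map ψ))
  refine ⟨ψ f₁, ψ f₂, h₁.map ψ, h₂.map ψ, ?_, ?_⟩
  · rw [← map_commutatorElement, ← map_commutatorElement]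
    rwa [Ne, map_eq_one_iff ψ ψ.injective]
  · rw [← map_commutatorElement, ← map_commutatorElement]
    exact h₄.map ψ

namespace ThompsonV

open Cantor Pointwise

/-- The set of the points at which the germ of `v` is not trivial. -/
def gsupp (v : ThompsonV) : Set Cantor := {x | ¬ ∀ᶠ y in 𝓝 x, v • y = y}

theorem suppIn_gsupp (v : ThompsonV) : SuppIn (gsupp v) v := fun _ hx => (not_not.1 hx).self_of_nhds

theorem mem_gsupp_of_smul_ne {v : ThompsonV} {x : Cantor} (h : v • x ≠ x) : x ∈ gsupp v :=
  fun he => h he.self_of_nhds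

theorem isClosed_gsupp (v : ThompsonV) : IsClosed (gsupp v) :=
  ⟨by
    have h : (gsupp v)ᶜ = {x | ∀ᶠ y in 𝓝 x, v • y = y} := by ext x; exact not_not
    rw [h]
    exact isOpen_setOfPred_eventually_nhds⟩

/-- On an adapted interval `v` replaces a prefix `m` by `w`. Its germs there are all trivial if `w =
m`, and none is trivial otherwise, because the two words can be recovered from any smaller interval.
-/
theorem isOpen_gsupp (v : ThompsonV) : IsOpen (gsupp v) := by
  rw [isOpen_iff_mem_nhds]
  intro x hx
  obtain ⟨m, w, hxm, hmw⟩ := exists_adapted_smul v x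
  have hne : w ≠ m := by
    rintro rfl
    refine hx ?_
    filter_upwards [sdi_mem_nhds hxm]
    rintro _ ⟨z, rfl⟩
    exact hmw z
  filter_upwards [sdi_mem_nhds hxm] with y hy he
  obtain ⟨n, hn, hyn, hsub⟩ := exists_sdi_subset_of_mem_nhds he m.length
  obtain ⟨z, rfl⟩ := hy
  obtain ⟨z', hz'⟩ := hyn
  have : ∃ u, n = m ++ u := by
    rcases prepend_compare hz' with ⟨u, hu, -⟩ | ⟨u, hu, -⟩
    · rw [hu, List.length_append] at hn
      have : u = [] := List.length_eq_zero_iff.1 (by omega)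
      exact ⟨[], by simp [hu, this]⟩
    · exact ⟨u, hu⟩
  obtain ⟨u, rfl⟩ := this
  apply hne
  apply List.append_cancel_right (bs := u)
  refine word_ext fun t => ?_
  rw [prepend_append, ← hmw, ← prepend_append]
  exact hsub ⟨t, rfl⟩

theorem exists_smul_ne_of_mem_gsupp {v : ThompsonV} {x : Cantor} (hx : x ∈ gsupp v)
    {U : Set Cantor} (hU : IsOpen U) (hxU : x ∈ U) : ∃ y ∈ U, v • y ≠ y := by
  by_contra! h
  exact hx (Filter.mem_of_superset (hU.mem_nhds hxU) h)

theorem gsupp_subset_of_suppIn {v : ThompsonV} {A : Set Cantor} (hA : IsClosed A)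
    (h : SuppIn A v) : gsupp v ⊆ A := by
  intro x hx
  by_contra hxA
  obtain ⟨y, hy, hy'⟩ := exists_smul_ne_of_mem_gsupp hx hA.isOpen_compl hxA
  exact hy' (h y hy)

theorem gsupp_nonempty {v : ThompsonV} (h : v ≠ 1) : (gsupp v).Nonempty := by
  obtain ⟨x, hx⟩ := exists_smul_ne h
  exact ⟨x, mem_gsupp_of_smul_ne hx⟩

theorem ne_one_of_mem_gsupp {v : ThompsonV} {x : Cantor} (h : x ∈ gsupp v) : v ≠ 1 := by
  rintro rfl
  exact h (Filter.Eventually.of_forall fun y => one_smul _ y)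

theorem smul_mem_gsupp_iff (v h : ThompsonV) (x : Cantor) :
    v • x ∈ gsupp h ↔ x ∈ gsupp (v⁻¹ * h * v) := by
  have key : ∀ (v h : ThompsonV) (x : Cantor), v • x ∈ gsupp h → x ∈ gsupp (v⁻¹ * h * v) := by
    intro v h x hx he
    apply hx
    have := (continuous_const_smul v⁻¹).tendsto (v • x)
    rw [inv_smul_smul] at this
    filter_upwards [this.eventually he] with y hy
    rw [mul_smul, mul_smul, smul_inv_smul] at hy
    exact smul_left_cancel _ hy
  refine ⟨key v h x, fun hx => ?_⟩
  have := key v⁻¹ (v⁻¹ * h * v) (v • x) (by rwa [inv_smul_smul])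
  convert this using 2
  group

theorem exists_gsupp_eq_sdi (m : List Bool) : ∃ v : ThompsonV, gsupp v = sdi m := by
  have hd : Disjoint (sdi (m ++ [false])) (sdi (m ++ [true])) :=
    disjoint_sdi_append m (disjoint_sdi_of_length_eq rfl (by simp))
  obtain ⟨s, hs, hs', hc, -⟩ := exists_swap hd
  refine ⟨s, (gsupp_subset_of_suppIn (isClopen_sdi m).1 (SuppIn.mono hc ?_)).antisymm ?_⟩
  · exact Set.union_subset (sdi_append_subset _ _) (sdi_append_subset _ _)
  · rintro _ ⟨z, rfl⟩
    apply mem_gsupp_of_smul_ne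
    have hz : prepend m z = prepend (m ++ [z 0]) fun n => z (n + 1) := by
      rw [prepend_append]
      exact congrArg _ (cons_head_tail z).symm
    rw [hz]
    cases z 0
    · rw [hs]
      exact fun h => Set.disjoint_right.1 hd ⟨_, rfl⟩ ⟨_, h.symm⟩
    · rw [hs']
      exact fun h => Set.disjoint_left.1 hd ⟨_, rfl⟩ ⟨_, h.symm⟩

/-- The product of swaps squeezes the subinterval `j0` into `j00`, so no positive power of it is
trivial. -/
theorem exists_pow_ne_one (j : List Bool) :
    ∃ g : ThompsonV, SuppIn (sdi j) g ∧ ∀ n, g ^ (n + 1) ≠ 1 := by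
  obtain ⟨s, hs, -, hsc, -⟩ := exists_swap (a := j ++ [true]) (b := j ++ [false])
    (disjoint_sdi_append j (disjoint_sdi_of_length_eq rfl (by simp)))
  obtain ⟨t, ht, -, htc, -⟩ := exists_swap (a := j ++ [false]) (b := j ++ [true, false])
    (disjoint_sdi_append j ((disjoint_sdi_of_length_eq (m := [false]) (w := [true]) rfl
      (by simp)).mono_right (sdi_append_subset [true] [false])))
  have hsub : ∀ p q : List Bool, sdi (j ++ p) ∪ sdi (j ++ q) ⊆ sdi j := fun p q =>
    Set.union_subset (sdi_append_subset _ _) (sdi_append_subset _ _)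
  refine ⟨s * t, (SuppIn.mono hsc (hsub _ _)).mul (SuppIn.mono htc (hsub _ _)), fun n hn => ?_⟩
  have hst : ∀ z, (s * t) • prepend (j ++ [false]) z = prepend (j ++ [false]) (cons false z) := by
    intro z
    have h : prepend (j ++ [true, false]) z = prepend (j ++ [true]) (cons false z) := by
      rw [prepend_append, prepend_append]; rfl
    rw [mul_smul, ht, h, hs]
  have hpow : ∀ n z, (s * t) ^ n • prepend (j ++ [false]) z =
      prepend (j ++ [false]) ((cons false)^[n] z) := by
    intro n
    induction n with
    | zero => intro z; rw [pow_zero, one_smul]; rfl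
    | succ n ih => intro z; rw [pow_succ, mul_smul, hst, ih]; rfl
  have h := hpow (n + 1) fun _ => true
  rw [hn, one_smul, Function.iterate_succ_apply'] at h
  have h0 := congrFun (prepend_injective _ h) 0
  simp [cons] at h0

/-- If `k` does not commute with `f`, both move some common point. Near it, off the support of `g`,
lies an interval displaced by `k`; non-commuting elements supported there are the witnesses, since
the inner bracket with `k` can be dropped. -/
theorem algDisjoint_of_disjoint {f g : ThompsonV} (h : Disjoint (gsupp f) (gsupp g)) :
    AlgDisjoint f g := by
  intro k hk
  obtain ⟨x, hfx, hkx⟩ : ∃ x : Cantor, f • x ≠ x ∧ k • x ≠ x := by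
    by_contra! hc
    refine hk (SuppIn.commute (A := {x : Cantor | f • x ≠ x}) (B := {x : Cantor | k • x ≠ x})
      (Set.disjoint_left.2 fun x hx hx' => hx' (hc x hx)) ?_ ?_)
    · exact fun x hx => not_not.1 hx
    · exact fun x hx => not_not.1 hx
  obtain ⟨U, hU, hxU, hd⟩ := exists_displaced_nhds hkx
  obtain ⟨j, -, -, hj⟩ := exists_sdi_subset (hU.inter (isClosed_gsupp g).isOpen_compl)
    ⟨hxU, Set.disjoint_left.1 h (mem_gsupp_of_smul_ne hfx)⟩ 0
  obtain ⟨f₁, f₂, g₁, g₂, hf₁, hf₂, hg₁, hg₂, y, hy, hne⟩ := exists_commutators_not_commute j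
  have hjg : Disjoint (sdi j) (gsupp g) :=
    Set.disjoint_left.2 fun z hz hz' => (hj hz).2 hz'
  have hc : ∀ v : ThompsonV, SuppIn (sdi j) v → Commute v g := fun v hv =>
    SuppIn.commute hjg hv (suppIn_gsupp g)
  have hf := hf₁.commutator hf₂
  have hg := hg₁.commutator hg₂
  refine ⟨⁅f₁, f₂⁆, ⁅g₁, g₂⁆, hc _ hf, hc _ hg, ?_⟩
  rw [commutator_commutator_of_displaced hf hg
    (disjoint_smul_mono hd (hj.trans Set.inter_subset_left))]
  refine ⟨fun h1 => hne ?_, hc _ (hf.commutator hg)⟩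
  rw [← mul_smul, ← mul_smul, commutatorElement_eq_one_iff_mul_comm.1 h1]

/-- Expanding the double bracket gives `h` and its inverse conjugated by 1, `f₂`, `f₁` and `f₁ *
f₂`. The number four of translates governs the exponent 12 used below. -/
theorem smul_commutator_commutator_ne {J : Set Cantor} {f₁ f₂ h : ThompsonV} (hh : SuppIn J h)
    {x : Cantor} (hx : ⁅f₁, ⁅f₂, h⁆⁆ • x ≠ x) :
    ∃ i : Fin 4, x ∈ (![1, f₂, f₁, f₁ * f₂] i) • J := by
  by_contra! hc
  apply hx
  have h₀ : x ∉ J := by simpa using hc 0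
  have h₁ : x ∉ f₂ • J := hc 1
  have h₂ : x ∉ f₁ • J := hc 2
  have h₃ : x ∉ (f₁ * f₂) • J := hc 3
  have key : ∀ y, y ∉ J → y ∉ f₂ • J → ⁅f₂, h⁆ • y = y := by
    intro y hy hy'
    rw [commutatorElement_def, mul_smul, hh.inv y hy, hh.conj f₂ y hy']
  have h₄ : ⁅f₂, h⁆⁻¹ • x = x := inv_smul_eq_iff.2 (key x h₀ h₁).symm
  rw [commutatorElement_def, mul_smul, h₄, mul_smul, mul_smul, key, smul_inv_smul]
  · rwa [← Set.mem_smul_set_iff_inv_smul_mem]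
  · rwa [← Set.mem_smul_set_iff_inv_smul_mem, ← mul_smul]

/-- A point moved by both `f` and `g ^ 12` has a neighbourhood displaced by `f` and by the first
four powers of `g`. The double bracket commutes with `g`, so its support is `g`-invariant; but it
lies in four translates of that neighbourhood, which cannot accommodate five successive `g`-iterates
of a point. -/
theorem disjoint_gsupp_of_algDisjoint {f g : ThompsonV} (h : AlgDisjoint f g) :
    Disjoint (gsupp f) (gsupp (g ^ 12)) := by
  rw [Set.disjoint_left]
  intro x hxf hxg
  obtain ⟨y, hy, hfy⟩ := exists_smul_ne_of_mem_gsupp hxf (isOpen_gsupp (g ^ 12)) hxg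
  obtain ⟨y, hfy, hgy⟩ := exists_smul_ne_of_mem_gsupp hy (isOpen_setOf_smul_ne f) hfy
  -- The exponent 12 is the least common multiple of 1, 2, 3 and 4.
  have hpow : ∀ i : Fin 4, g ^ (i.1 + 1) • y ≠ y := by
    intro i hi
    apply hgy
    obtain ⟨n, hn⟩ : ∃ n, 12 = (i.1 + 1) * n := by
      fin_cases i
      exacts [⟨12, rfl⟩, ⟨6, rfl⟩, ⟨4, rfl⟩, ⟨3, rfl⟩]
    rw [hn, pow_mul]
    generalize g ^ (i.1 + 1) = k at hi
    clear hn
    induction n with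
    | zero => rw [pow_zero, one_smul]
    | succ n ih => rw [pow_succ, mul_smul, hi, ih]
  obtain ⟨U, hU, hyU, hUd⟩ := exists_displaced_nhds hfy
  choose W hW hyW hWd using fun i => exists_displaced_nhds (hpow i)
  obtain ⟨j, -, -, hj⟩ := exists_sdi_subset (hU.inter (isOpen_iInter_of_finite hW))
    ⟨hyU, Set.mem_iInter.2 hyW⟩ 0
  have hfj := disjoint_smul_mono hUd (hj.trans Set.inter_subset_left)
  have hgj : ∀ i : Fin 4, Disjoint (sdi j) (g ^ (i.1 + 1) • sdi j) := fun i =>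
    disjoint_smul_mono (hWd i)
      ((hj.trans Set.inter_subset_right).trans (Set.iInter_subset _ _))
  obtain ⟨k, hk, hk1⟩ := exists_pow_ne_one j
  have hfk : ¬ Commute f k := by
    intro hc
    obtain ⟨z, hz⟩ := exists_smul_ne (by simpa using hk1 0)
    have hzj : z ∈ sdi j := by
      by_contra hzj
      exact hz (hk z hzj)
    have h' := hk.conj f z (Set.disjoint_left.1 hfj hzj)
    rw [hc.eq, mul_inv_cancel_right] at h'
    exact hz h'
  obtain ⟨f₁, f₂, h₁, h₂, hne, hc⟩ := h k hfk
  obtain ⟨z, hz⟩ := exists_smul_ne hne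
  have horb : ∀ i : Fin 5, ∃ l : Fin 4, g ^ i.1 • z ∈ (![1, f₂, f₁, f₁ * f₂] l) • sdi j := by
    intro i
    refine smul_commutator_commutator_ne hk fun he => hz ?_
    rw [← mul_smul, (hc.pow_right i.1).eq, mul_smul] at he
    exact smul_left_cancel _ he
  choose l hl using horb
  -- Two of the five iterates share a translate of the interval by an element commuting with `g`, so
  -- `g ^ (q - p)`, with `q - p` at most 4, carries a point of the interval into it.
  obtain ⟨p, q, hpq, hlpq⟩ := Fintype.exists_ne_map_eq_of_card_lt l (by simp)
  wlog hlt : p < q generalizing p q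
  · exact this q p hpq.symm hlpq.symm (lt_of_le_of_ne (not_lt.1 hlt) hpq.symm)
  have hcl : ∀ l : Fin 4, Commute (![1, f₂, f₁, f₁ * f₂] l) g := by
    intro l
    fin_cases l
    exacts [Commute.one_left g, h₂, h₁, h₁.mul_left h₂]
  have hp := hl p
  have hq := hl q
  rw [← hlpq] at hq
  have hcp := hcl (l p)
  generalize (![1, f₂, f₁, f₁ * f₂] (l p)) = e at hp hq hcp
  rw [Set.mem_smul_set_iff_inv_smul_mem] at hp hq
  have hmem : ∀ n : ℕ, e⁻¹ • g ^ n • z = g ^ n • e⁻¹ • z := fun n => by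
    rw [← mul_smul, ← mul_smul, (hcp.inv_left.pow_right n).eq]
  rw [hmem] at hp hq
  have hlt' : p.1 < q.1 := hlt
  refine Set.disjoint_left.1 (hgj ⟨q.1 - p.1 - 1, by omega⟩) hq ?_
  refine Set.mem_smul_set.2 ⟨_, hp, ?_⟩
  rw [← mul_smul, ← pow_add]
  congr 2
  simp only
  omega

/-- The inclusion of supports can be read off the group `V`. -/
theorem gsupp_subset_iff {f h : ThompsonV} :
    gsupp f ⊆ gsupp h ↔ ∀ g, AlgDisjoint h g → Commute f (g ^ 12) := by
  constructor
  · intro hfh g hg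
    exact SuppIn.commute ((disjoint_gsupp_of_algDisjoint hg).mono_left hfh) (suppIn_gsupp f)
      (suppIn_gsupp _)
  · intro H x hx
    by_contra hxh
    obtain ⟨y, hy, hfy⟩ := exists_smul_ne_of_mem_gsupp hx (isClosed_gsupp h).isOpen_compl hxh
    obtain ⟨U, hU, hyU, hUd⟩ := exists_displaced_nhds hfy
    obtain ⟨j, -, -, hj⟩ := exists_sdi_subset (hU.inter (isClosed_gsupp h).isOpen_compl)
      ⟨hyU, hy⟩ 0
    -- Infinite order ensures `g ^ 12 ≠ 1`; as `f` displaces the interval, it cannot commute with a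
    -- nontrivial element supported in it.
    obtain ⟨g, hg, hg1⟩ := exists_pow_ne_one j
    have hc := H g (algDisjoint_of_disjoint <| Set.disjoint_right.2 fun z hz =>
      (hj (gsupp_subset_of_suppIn (isClopen_sdi j).1 hg hz)).2)
    obtain ⟨z, hz⟩ := exists_smul_ne (hg1 11)
    have hg12 := hg.pow 12
    have hzj : z ∈ sdi j := by
      by_contra hzj
      exact hz (hg12 z hzj)
    have h' := hg12.conj f z (Set.disjoint_left.1
      (disjoint_smul_mono hUd (hj.trans Set.inter_subset_left)) hzj)
    rw [hc.eq, mul_inv_cancel_right] at h'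
    exact hz h'

theorem gsupp_map_subset {ψ : ThompsonV ≃* ThompsonV} {f h : ThompsonV}
    (H : gsupp f ⊆ gsupp h) : gsupp (ψ f) ⊆ gsupp (ψ h) := by
  rw [gsupp_subset_iff] at *
  intro g hg
  have h₁ := hg.map ψ.symm
  rw [ψ.symm_apply_apply] at h₁
  have h₂ := (H _ h₁).map ψ
  rwa [map_pow, ψ.apply_symm_apply] at h₂

/-- The points `x` and `y` correspond to each other under the automorphism `ψ`. -/
def Matches (ψ : ThompsonV ≃* ThompsonV) (x y : Cantor) : Prop :=
  ∀ h, x ∈ gsupp h ↔ y ∈ gsupp (ψ h)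

theorem Matches.symm {ψ : ThompsonV ≃* ThompsonV} {x y : Cantor} (h : Matches ψ x y) :
    Matches ψ.symm y x := fun k => by rw [h, ψ.apply_symm_apply]

theorem Matches.unique {ψ : ThompsonV ≃* ThompsonV} {x y y' : Cantor} (h : Matches ψ x y)
    (h' : Matches ψ x y') : y = y' := by
  by_contra hne
  obtain ⟨m, -, hy, hm⟩ := exists_sdi_subset isOpen_ne (show y ∈ {z | z ≠ y'} from hne) 0
  obtain ⟨k, hk⟩ := exists_gsupp_eq_sdi m
  obtain ⟨k, rfl⟩ := ψ.surjective k
  rw [← hk, ← h, h', hk] at hy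
  exact hm hy rfl

/-- Supports of the images of elements whose support contains `x` form a directed family of nonempty
compact sets, so they have a common point. -/
theorem exists_matches (ψ : ThompsonV ≃* ThompsonV) (x : Cantor) : ∃ y, Matches ψ x y := by
  have hne : Nonempty {h : ThompsonV // x ∈ gsupp h} := by
    obtain ⟨v, hv⟩ := exists_gsupp_eq_sdi []
    exact ⟨v, by rw [hv]; exact ⟨x, rfl⟩⟩
  obtain ⟨y, hy⟩ := IsCompact.nonempty_iInter_of_directed_nonempty_isCompact_isClosed
    (fun h : {h : ThompsonV // x ∈ gsupp h} => gsupp (ψ h.1)) (by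
      rintro ⟨h₁, hx₁⟩ ⟨h₂, hx₂⟩
      obtain ⟨m, -, hx, hm⟩ := exists_sdi_subset ((isOpen_gsupp h₁).inter (isOpen_gsupp h₂))
        ⟨hx₁, hx₂⟩ 0
      obtain ⟨k, hk⟩ := exists_gsupp_eq_sdi m
      refine ⟨⟨k, hk ▸ hx⟩, gsupp_map_subset ?_, gsupp_map_subset ?_⟩
      · rw [hk]; exact hm.trans Set.inter_subset_left
      · rw [hk]; exact hm.trans Set.inter_subset_right)
    (fun h => gsupp_nonempty (by simpa using ne_one_of_mem_gsupp h.2))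
    (fun h => (isClosed_gsupp _).isCompact) (fun h => isClosed_gsupp _)
  rw [Set.mem_iInter] at hy
  refine ⟨y, fun h => ⟨fun hx => hy ⟨h, hx⟩, fun hyh => ?_⟩⟩
  by_contra hx
  obtain ⟨m, -, hxm, hm⟩ := exists_sdi_subset (isClosed_gsupp h).isOpen_compl hx 0
  obtain ⟨k, hk⟩ := exists_gsupp_eq_sdi m
  obtain ⟨n, -, hyn, hn⟩ := exists_sdi_subset ((isOpen_gsupp (ψ k)).inter (isOpen_gsupp (ψ h)))
    ⟨hy ⟨k, hk ▸ hxm⟩, hyh⟩ 0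
  obtain ⟨l, hl⟩ := exists_gsupp_eq_sdi n
  -- The pullback of `l` is nontrivial, yet its support would lie in those of both `k` and `h`,
  -- which are disjoint.
  obtain ⟨z, hz⟩ := gsupp_nonempty (v := ψ.symm l)
    (by simpa using ne_one_of_mem_gsupp (hl ▸ hyn))
  have h₁ := gsupp_map_subset (ψ := ψ.symm) (hl.trans_subset (hn.trans Set.inter_subset_left)) hz
  have h₂ := gsupp_map_subset (ψ := ψ.symm) (hl.trans_subset (hn.trans Set.inter_subset_right)) hz
  rw [ψ.symm_apply_apply] at h₁ h₂
  exact hm (hk ▸ h₁) h₂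

theorem continuous_of_matches {ψ : ThompsonV ≃* ThompsonV} {f : Cantor → Cantor}
    (hf : ∀ x, Matches ψ x (f x)) : Continuous f := by
  rw [continuous_iff_continuousAt]
  intro x U hU
  obtain ⟨m, -, hx, hm⟩ := exists_sdi_subset_of_mem_nhds hU 0
  obtain ⟨k, hk⟩ := exists_gsupp_eq_sdi m
  obtain ⟨k, rfl⟩ := ψ.surjective k
  have hxk : x ∈ gsupp k := by rw [hf x, hk]; exact hx
  refine Filter.mem_map.2 <| Filter.mem_of_superset ((isOpen_gsupp k).mem_nhds hxk) fun z hz => hm ?_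
  rw [← hk]
  exact (hf z k).1 hz

/-- Every automorphism of `V` is implemented by a homeomorphism of the Cantor space. -/
theorem exists_homeomorph_of_mulEquiv (ψ : ThompsonV ≃* ThompsonV) :
    ∃ φ : Cantor ≃ₜ Cantor, ∀ (v : ThompsonV) (x : Cantor), φ (v • x) = ψ v • φ x := by
  choose f hf using exists_matches ψ
  choose g hg using exists_matches ψ.symm
  have hg' : ∀ y, Matches ψ (g y) y := fun y => (hg y).symm
  refine ⟨⟨⟨f, g, fun x => (hg (f x)).unique (hf x).symm, fun y => (hf (g y)).unique (hg' y)⟩,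
    continuous_of_matches hf, continuous_of_matches hg⟩, fun v x => ?_⟩
  refine (hf (v • x)).unique fun h => ?_
  rw [smul_mem_gsupp_iff, smul_mem_gsupp_iff, hf x]
  simp

end ThompsonV

/-! ### Realising germs of `V` with prescribed support -/

namespace ThompsonV

open Cantor Pointwise

/-- Two comparable prefixes can be exchanged inside the bigger interval after a refinement. -/
theorem exists_suppIn_adapted_append (m t r : List Bool) (hr : r.length = 2) :
    ∃ s : ThompsonV, SuppIn (sdi m) s ∧
      ∀ z, s • prepend (m ++ r) z = prepend (m ++ t ++ r) z := by
  obtain ⟨p, q, htr⟩ : ∃ p q, t ++ r = p ++ q ∧ p.length = 2 :=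
    ⟨(t ++ r).take 2, (t ++ r).drop 2, (List.take_append_drop _ _).symm, by simp; omega⟩
  -- With four words of length 2, one avoids both `r` and `p`. Its interval is a parking place: one
  -- swap moves `m ++ r` there and a second moves it on to `m ++ t ++ r`, even if these two overlap.
  obtain ⟨d, hd, hdr, hdp⟩ : ∃ d : List Bool, d.length = 2 ∧ r ≠ d ∧ p ≠ d := by
    by_contra! h
    have h₁ := h [false, false] rfl
    have h₂ := h [false, true] rfl
    have h₃ := h [true, false] rfl
    by_cases e₁ : r = [false, false] <;> by_cases e₂ : r = [false, true] <;>
      by_cases e₃ : r = [true, false] <;> simp_all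
  have hp := htr.2
  obtain ⟨s, hs, -, hsc, -⟩ := exists_swap (a := m ++ r) (b := m ++ d)
    (disjoint_sdi_append m (disjoint_sdi_of_length_eq (hr.trans hd.symm) hdr))
  obtain ⟨s', -, hs', hsc', -⟩ := exists_swap (a := m ++ (p ++ q)) (b := m ++ d)
    (disjoint_sdi_append m ((disjoint_sdi_of_length_eq (hp.trans hd.symm) hdp).mono_left
      (sdi_append_subset _ _)))
  have hsub : ∀ p q : List Bool, sdi (m ++ p) ∪ sdi (m ++ q) ⊆ sdi m := fun p q =>
    Set.union_subset (sdi_append_subset _ _) (sdi_append_subset _ _)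
  refine ⟨s' * s, (SuppIn.mono hsc' (hsub _ _)).mul (SuppIn.mono hsc (hsub _ _)), fun z => ?_⟩
  rw [mul_smul, hs, hs', ← htr.1, List.append_assoc]

/-- A germ of `V` with source and target in an open set `W` is the germ of an element of `V`
supported in `W`. -/
theorem exists_suppIn_germ_eq {W : Set Cantor} (hW : IsOpen W) {x : Cantor} {u : ThompsonV}
    (hx : x ∈ W) (hux : u • x ∈ W) :
    ∃ v : ThompsonV, SuppIn W v ∧ ∀ᶠ y in 𝓝 x, v • y = u • y := by
  obtain ⟨m₀, w₀, hm₀, h₀⟩ := exists_adapted_smul u x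
  have hpre : IsOpen ({y : Cantor | y ∈ W} ∩ (fun y => u • y) ⁻¹' W ∩ sdi m₀) :=
    (hW.inter (hW.preimage (continuous_const_smul u))).inter (isOpen_sdi m₀)
  obtain ⟨m, hlen, hxm, hm⟩ := exists_sdi_subset hpre ⟨⟨hx, hux⟩, hm₀⟩ m₀.length
  obtain ⟨w, hw⟩ : ∃ w, ∀ z, u • prepend m z = prepend w z := by
    obtain ⟨y, hy⟩ := (hm ⟨fun _ => false, rfl⟩).2
    obtain ⟨p, rfl⟩ : ∃ p, m = m₀ ++ p := by
      rcases prepend_compare hy with ⟨p, hp, -⟩ | ⟨p, hp, -⟩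
      · exact ⟨p, hp⟩
      · rw [hp, List.length_append] at hlen
        have : p = [] := List.length_eq_zero_iff.1 (by omega)
        exact ⟨[], by simp [hp, this]⟩
    exact ⟨w₀ ++ p, fun z => by rw [prepend_append, h₀, ← prepend_append]⟩
  have hmW : sdi m ⊆ W := fun y hy => (hm hy).1.1
  have hwW : sdi w ⊆ W := by
    rintro _ ⟨z, rfl⟩
    rw [← hw]
    exact (hm ⟨z, rfl⟩).1.2
  suffices h : ∃ r : List Bool, x ∈ sdi (m ++ r) ∧ ∃ v : ThompsonV, SuppIn W v ∧
      ∀ z, v • prepend (m ++ r) z = prepend (w ++ r) z by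
    obtain ⟨r, hxr, v, hv, hvr⟩ := h
    refine ⟨v, hv, Filter.mem_of_superset (sdi_mem_nhds hxr) ?_⟩
    rintro _ ⟨z, rfl⟩
    show v • _ = u • _
    rw [hvr, prepend_append, prepend_append, hw]
  obtain ⟨y, rfl⟩ := hxm
  obtain ⟨r, hr, z, rfl⟩ := exists_word 2 y
  refine ⟨r, ⟨z, prepend_append _ _ _⟩, ?_⟩
  by_cases hd : Disjoint (sdi m) (sdi w)
  · obtain ⟨s, hs, -, hsc, -⟩ := exists_swap hd
    refine ⟨s, SuppIn.mono hsc (Set.union_subset hmW hwW), fun z => ?_⟩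
    rw [prepend_append, prepend_append, hs]
  · obtain ⟨_, ⟨y₁, rfl⟩, y₂, hy⟩ := Set.not_disjoint_iff.1 hd
    rcases prepend_compare hy with ⟨t, rfl, -⟩ | ⟨t, rfl, -⟩
    · obtain ⟨s, hs, h⟩ := exists_suppIn_adapted_append w t r hr
      exact ⟨s⁻¹, (hs.mono hwW).inv, fun z => by rw [← h, inv_smul_smul]⟩
    · obtain ⟨s, hs, h⟩ := exists_suppIn_adapted_append m t r hr
      exact ⟨s, hs.mono hmW, h⟩

end ThompsonV

/-! ### Germs of the twist and invariant central loops -/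

section Germ

open Cantor

variable {Γ : Type*} [Group Γ] (α₀ α₁ : MulAut Γ)

theorem tau_congr {v w : ThompsonV} {x : Cantor} (h : ∀ᶠ y in 𝓝 x, v • y = w • y) :
    tau α₀ α₁ v x = tau α₀ α₁ w x := by
  have key : tau α₀ α₁ (w⁻¹ * v) x = 1 := by
    have h' : ∀ᶠ y in 𝓝 x, (w⁻¹ * v) • y = y := by
      filter_upwards [h] with y hy
      rw [mul_smul, hy, inv_smul_smul]
    obtain ⟨m, -, hx, hm⟩ := exists_sdi_subset_of_mem_nhds h' 0
    rw [tau_eq α₀ α₁ _ hx (w := m) fun z => hm ⟨z, rfl⟩, inv_mul_cancel]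
  have hv : v = w * (w⁻¹ * v) := by group
  have hx : (w⁻¹ * v).1 x = x := by
    show (w⁻¹ * v) • x = x
    rw [mul_smul, h.self_of_nhds, inv_smul_smul]
  conv_lhs => rw [hv]
  rw [tau_mul, key, hx, mul_one]

theorem tau_eq_one {v : ThompsonV} {x : Cantor} (h : ∀ᶠ y in 𝓝 x, v • y = y) :
    tau α₀ α₁ v x = 1 := by
  rw [tau_congr α₀ α₁ (w := 1) (by simpa using h), tau_one]

theorem tau_mul_smul (v w : ThompsonV) (x : Cantor) :
    tau α₀ α₁ (v * w) x = tau α₀ α₁ v (w • x) * tau α₀ α₁ w x :=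
  tau_mul α₀ α₁ v w x

theorem isOpen_setOf_apply_eq {Γ : Type*} (a : LoopGroup Γ) (g : Γ) : IsOpen {x | a x = g} :=
  a.isLocallyConstant.isOpen_fiber g

theorem isClosed_setOf_apply_eq {Γ : Type*} (a : LoopGroup Γ) (g : Γ) : IsClosed {x | a x = g} :=
  a.isLocallyConstant.isClosed_fiber g

/-- A loop is invariant under the elements of `V` supported where it is trivial. -/
theorem jonesAction_eq_self_of_suppIn {a : LoopGroup Γ} {v : ThompsonV}
    (hv : SuppIn {x | a x = 1} v) : jonesAction α₀ α₁ v a = a := by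
  refine LocallyConstant.ext fun y => ?_
  rw [jonesAction_apply]
  by_cases hy : a y = 1
  · have : a (v⁻¹ • y) = 1 := hv.inv.smul_mem hy
    rw [this, hy, map_one]
  · rw [hv.inv y hy, tau_eq_one, MulAut.one_apply]
    filter_upwards [(isClosed_setOf_apply_eq a 1).isOpen_compl.mem_nhds hy] with z hz
    exact hv z hz

/-- The loops with central values that are invariant under the Jones action. -/
def invariantCenter : Subgroup (LoopGroup Γ) where
  carrier := {z | (∀ y, z y ∈ Subgroup.center Γ) ∧ ∀ (v : ThompsonV) (y : Cantor),
    z (v • y) = tau α₀ α₁ v y (z y)}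
  one_mem' := ⟨fun _ => Subgroup.one_mem _, fun v y => (map_one (tau α₀ α₁ v y)).symm⟩
  mul_mem' := fun {a b} ha hb => ⟨fun y => Subgroup.mul_mem _ (ha.1 y) (hb.1 y), fun v y => by
    rw [LocallyConstant.mul_apply, LocallyConstant.mul_apply, map_mul, ha.2, hb.2]⟩
  inv_mem' := fun {a} ha => ⟨fun y => Subgroup.inv_mem _ (ha.1 y), fun v y => by
    rw [LocallyConstant.inv_apply, LocallyConstant.inv_apply, map_inv, ha.2]⟩

variable {α₀ α₁}

/-- The trivial locus is open and nonempty, so every orbit enters it, and equivariance transports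
triviality back. Hence an invariant central loop is determined by a single value. -/
theorem eq_one_of_forall_smul_of_apply_eq_one {a : LoopGroup Γ}
    (ha : ∀ (v : ThompsonV) (y : Cantor), a (v • y) = tau α₀ α₁ v y (a y)) {x : Cantor}
    (hx : a x = 1) : a = 1 := by
  refine LocallyConstant.ext fun y => ?_
  obtain ⟨v, hv⟩ := ThompsonV.exists_smul_mem (isOpen_setOf_apply_eq a 1) ⟨x, hx⟩ y
  have hv' : a (v • y) = 1 := hv
  rw [ha] at hv'
  exact (map_eq_one_iff _ (tau α₀ α₁ v y).injective).1 hv'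

theorem eq_of_mem_invariantCenter {z z' : LoopGroup Γ} (hz : z ∈ invariantCenter α₀ α₁)
    (hz' : z' ∈ invariantCenter α₀ α₁) {y : Cantor} (h : z y = z' y) : z = z' := by
  have hm : z * z'⁻¹ ∈ invariantCenter α₀ α₁ := Subgroup.mul_mem _ hz (Subgroup.inv_mem _ hz')
  refine mul_inv_eq_one.1 (eq_one_of_forall_smul_of_apply_eq_one hm.2 (x := y) ?_)
  rw [LocallyConstant.mul_apply, LocallyConstant.inv_apply, h, mul_inv_cancel]

theorem commute_of_mem_invariantCenter {z : LoopGroup Γ} (hz : z ∈ invariantCenter α₀ α₁)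
    (a : LoopGroup Γ) : Commute z a :=
  LocallyConstant.ext fun y => ((Subgroup.mem_center_iff.1 (hz.1 y)) (a y)).symm

theorem jonesAction_of_mem_invariantCenter {z : LoopGroup Γ} (hz : z ∈ invariantCenter α₀ α₁)
    (v : ThompsonV) : jonesAction α₀ α₁ v z = z := by
  refine LocallyConstant.ext fun y => ?_
  rw [jonesAction_apply, ← hz.2, smul_inv_smul]

open SemidirectProduct in
theorem inl_mem_center {z : LoopGroup Γ} (hz : z ∈ invariantCenter α₀ α₁) :
    (inl z : FractionGroup α₀ α₁) ∈ Subgroup.center (FractionGroup α₀ α₁) := by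
  rw [Subgroup.mem_center_iff]
  intro g
  ext1
  · rw [mul_left, mul_left, left_inl, right_inl, jonesAction_of_mem_invariantCenter hz, map_one,
      MulAut.one_apply, (commute_of_mem_invariantCenter hz g.left).eq]
  · simp

theorem conj_eq_of_mem_center {Γ : Type*} [Group Γ] {h : Γ} (hh : h ∈ Subgroup.center Γ) (g : Γ) :
    g * h * g⁻¹ = h := by
  rw [Subgroup.mem_center_iff.1 hh, mul_inv_cancel_right]

theorem eq_of_conj_mem_center {Γ : Type*} [Group Γ] {g h : Γ}
    (hh : g * h * g⁻¹ ∈ Subgroup.center Γ) : g * h * g⁻¹ = h := by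
  have h' := conj_eq_of_mem_center hh g⁻¹
  rw [← h']
  group

theorem map_mem_center {Γ : Type*} [Group Γ] {h : Γ} (hh : h ∈ Subgroup.center Γ)
    (e : MulAut Γ) : e h ∈ Subgroup.center Γ := by
  rw [Subgroup.mem_center_iff] at *
  intro g
  obtain ⟨g, rfl⟩ := e.surjective g
  rw [← map_mul, hh, map_mul]

end Germ

/-! ### Locality of loop isomorphisms modulo the centre -/

open Cantor

/-- An isomorphism `κ` of loop groups which intertwines the Jones actions up to an automorphism `ψ` of
`V`, implemented by the homeomorphism `φ`, and up to conjugation by `c`. -/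
structure LoopIntertwiner {Γ Γ' : Type*} [Group Γ] [Group Γ'] (α₀ α₁ : MulAut Γ)
    (β₀ β₁ : MulAut Γ') where
  ψ : ThompsonV ≃* ThompsonV
  φ : Cantor ≃ₜ Cantor
  κ : LoopGroup Γ ≃* LoopGroup Γ'
  c : ThompsonV → LoopGroup Γ'
  map_smul : ∀ (v : ThompsonV) (x : Cantor), φ (v • x) = ψ v • φ x
  map_jonesAction : ∀ (v : ThompsonV) (a : LoopGroup Γ),
    κ (jonesAction α₀ α₁ v a) = c v * jonesAction β₀ β₁ (ψ v) (κ a) * (c v)⁻¹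

namespace LoopIntertwiner

variable {Γ Γ' : Type*} [Group Γ] [Group Γ'] {α₀ α₁ : MulAut Γ} {β₀ β₁ : MulAut Γ'}
  (D : LoopIntertwiner α₀ α₁ β₀ β₁)

/-- The twist of the target, read in the coordinates of the source. -/
noncomputable def twist (v : ThompsonV) (x : Cantor) : MulAut Γ' := tau β₀ β₁ (D.ψ v) (D.φ x)

theorem twist_mul (v w : ThompsonV) (x : Cantor) :
    D.twist (v * w) x = D.twist v (w • x) * D.twist w x := by
  rw [twist, map_mul, tau_mul_smul, ← D.map_smul, twist, twist]

theorem twist_congr {v w : ThompsonV} {x : Cantor} (h : ∀ᶠ y in 𝓝 x, v • y = w • y) :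
    D.twist v x = D.twist w x := by
  refine tau_congr β₀ β₁ ?_
  have ht := D.φ.symm.continuous.tendsto (D.φ x)
  rw [D.φ.symm_apply_apply] at ht
  filter_upwards [ht.eventually h] with y hy
  have h' := congrArg D.φ hy
  rwa [D.map_smul, D.map_smul, D.φ.apply_symm_apply] at h'

theorem twist_eq_one {v : ThompsonV} {x : Cantor} (h : ∀ᶠ y in 𝓝 x, v • y = y) :
    D.twist v x = 1 := by
  rw [D.twist_congr (w := 1) (by simpa using h), twist, map_one, tau_one]

theorem isLocallyConstant_twist (v : ThompsonV) : IsLocallyConstant (D.twist v) :=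
  (isLocallyConstant_tau β₀ β₁ (D.ψ v)).comp_continuous D.φ.continuous

theorem invariantCenter_apply_smul {z : LoopGroup Γ'} (hz : z ∈ invariantCenter β₀ β₁)
    (v : ThompsonV) (x : Cantor) : z (D.φ (v • x)) = D.twist v x (z (D.φ x)) := by
  rw [D.map_smul, hz.2]
  rfl

theorem map_jonesAction_apply (v : ThompsonV) (a : LoopGroup Γ) (x : Cantor) :
    D.κ (jonesAction α₀ α₁ v a) (D.φ (v • x)) =
      D.c v (D.φ (v • x)) * D.twist v x (D.κ a (D.φ x)) * (D.c v (D.φ (v • x)))⁻¹ := by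
  rw [D.map_jonesAction, LocallyConstant.mul_apply, LocallyConstant.mul_apply,
    LocallyConstant.inv_apply]
  congr 2
  rw [D.map_smul, jonesAction_smul]
  rfl

/-- At `φ x`, the images of loops on the interval and of loops on its complement commute and
together generate the target. Moving the interval off itself by an element of `V` trivial near `x`
shows that the first of these subgroups is abelian, hence central. -/
theorem apply_mem_center_of_forall_notMem_sdi {j : List Bool} {x : Cantor} (hx : x ∉ sdi j)
    {a : LoopGroup Γ} (ha : ∀ y, y ∉ sdi j → a y = 1) :
    D.κ a (D.φ x) ∈ Subgroup.center Γ' := by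
  have hJ := isClopen_sdi j
  obtain ⟨m, -, ⟨z, rfl⟩, hm⟩ := exists_sdi_subset hJ.compl.isOpen hx 0
  have hd : Disjoint (sdi (m ++ [z 0])) (sdi (m ++ [!z 0])) :=
    disjoint_sdi_append m (disjoint_sdi_of_length_eq rfl (by simp))
  have hje : ∀ r, Disjoint (sdi j) (sdi (m ++ r)) := fun r =>
    Set.disjoint_right.2 fun y hy => hm (sdi_append_subset _ _ hy)
  have hx0 : prepend m z ∈ sdi (m ++ [z 0]) :=
    ⟨fun n => z (n + 1), by rw [prepend_append]; exact congrArg _ (cons_head_tail z)⟩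
  obtain ⟨s, hs, hs', hsc, -⟩ := ThompsonV.exists_swap (hje [!z 0])
  set x := prepend m z
  have hsx : ∀ᶠ y in 𝓝 x, s • y = y := by
    filter_upwards [sdi_mem_nhds hx0] with y hy
    refine hsc y ?_
    rintro (h | h)
    · exact Set.disjoint_left.1 (hje _) h hy
    · exact Set.disjoint_left.1 hd hy h
  have hcomm : ∀ {a b : LoopGroup Γ}, (∀ y, y ∉ sdi j → a y = 1) → (∀ y, y ∉ sdi j → b y = 1) →
      Commute (D.κ a (D.φ x)) (D.c s (D.φ x) * D.κ b (D.φ x) * (D.c s (D.φ x))⁻¹) := by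
    intro a b ha hb
    have h₁ : Commute a (jonesAction α₀ α₁ s b) := by
      refine loopGroup_commute_of_disjoint (hje [!z 0]) ha fun y hy => ?_
      rw [jonesAction_apply, hb, map_one]
      rintro ⟨t, ht⟩
      refine hy ⟨t, ?_⟩
      rw [← hs, ht, smul_inv_smul]
    have h₂ := congrArg (fun f : LoopGroup Γ' => f (D.φ x)) (h₁.map D.κ).eq
    have h₃ := D.map_jonesAction_apply s b x
    rw [hsx.self_of_nhds, D.twist_eq_one hsx, MulAut.one_apply] at h₃
    rw [← h₃]
    exact h₂
  -- Surjectivity of `D.κ` is used on constant loops, whose preimages are cut along the interval.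
  have split : ∀ h : Γ', ∃ d d' : LoopGroup Γ, (∀ y, y ∉ sdi j → d y = 1) ∧
      (∀ y, y ∉ (sdi j)ᶜ → d' y = 1) ∧ h = D.κ d (D.φ x) * D.κ d' (D.φ x) := by
    intro h
    obtain ⟨d, hd⟩ := D.κ.surjective (LocallyConstant.const _ h)
    refine ⟨d.mulIndicator hJ, d.mulIndicator hJ.compl,
      fun y hy => LocallyConstant.mulIndicator_of_notMem _ _ hy,
      fun y hy => LocallyConstant.mulIndicator_of_notMem _ _ hy, ?_⟩
    rw [← LocallyConstant.mul_apply, ← map_mul, mulIndicator_mul_mulIndicator_compl, hd]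
    rfl
  have hdisj : ∀ {a d' : LoopGroup Γ}, (∀ y, y ∉ sdi j → a y = 1) →
      (∀ y, y ∉ (sdi j)ᶜ → d' y = 1) → Commute (D.κ a (D.φ x)) (D.κ d' (D.φ x)) := by
    intro a d' ha hd'
    exact congrArg (fun f : LoopGroup Γ' => f (D.φ x))
      ((loopGroup_commute_of_disjoint disjoint_compl_right ha hd').map D.κ).eq
  have habel : ∀ {b : LoopGroup Γ}, (∀ y, y ∉ sdi j → b y = 1) →
      Commute (D.κ a (D.φ x)) (D.κ b (D.φ x)) := by
    intro b hb
    obtain ⟨d, d', hdj, hd', hsplit⟩ := split (D.c s (D.φ x))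
    -- Replacing `b` by `d⁻¹ * b * d` cancels the conjugation by `D.c s`: its factor from `d` is
    -- undone, and its factor from `d'` commutes.
    have hb' : ∀ y, y ∉ sdi j → (d⁻¹ * b * d) y = 1 := fun y hy => by
      rw [LocallyConstant.mul_apply, LocallyConstant.mul_apply, LocallyConstant.inv_apply,
        hdj y hy, hb y hy]
      simp
    have h := hcomm ha hb'
    have h' := (hdisj hb' hd').eq
    convert h using 1
    rw [hsplit]
    calc D.κ b (D.φ x) = D.κ d (D.φ x) * D.κ (d⁻¹ * b * d) (D.φ x) * (D.κ d (D.φ x))⁻¹ := by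
          rw [map_mul, map_mul, map_inv, LocallyConstant.mul_apply, LocallyConstant.mul_apply,
            LocallyConstant.inv_apply]
          group
      _ = D.κ d (D.φ x) * (D.κ (d⁻¹ * b * d) (D.φ x) * D.κ d' (D.φ x)) *
            (D.κ d' (D.φ x))⁻¹ * (D.κ d (D.φ x))⁻¹ := by group
      _ = _ := by rw [h']; group
  rw [Subgroup.mem_center_iff]
  intro h
  obtain ⟨d, d', hdj, hd', rfl⟩ := split h
  exact ((habel hdj).mul_right (hdisj ha hd')).eq.symm

/-- The loop is trivial on some interval around `x`. Removing the sibling interval costs a central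
factor and enlarges the trivial interval to its parent; this is iterated up to the whole space. -/
theorem apply_mem_center {a : LoopGroup Γ} {x : Cantor} (hax : a x = 1) :
    D.κ a (D.φ x) ∈ Subgroup.center Γ' := by
  obtain ⟨m, -, hx, hm⟩ := exists_sdi_subset (isOpen_setOf_apply_eq a 1) hax 0
  clear hax
  induction m using List.reverseRecOn generalizing a with
  | nil =>
    have h : a = 1 := LocallyConstant.ext fun y => hm ⟨y, rfl⟩
    rw [h, map_one]
    exact Subgroup.one_mem _
  | append_singleton m b ih =>
    have hd : Disjoint (sdi (m ++ [b])) (sdi (m ++ [!b])) :=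
      disjoint_sdi_append m (disjoint_sdi_of_length_eq rfl (by simp))
    have hU := isClopen_sdi (m ++ [!b])
    rw [← mulIndicator_mul_mulIndicator_compl a hU, map_mul, LocallyConstant.mul_apply]
    refine Subgroup.mul_mem _ ?_ (ih (sdi_append_subset _ _ hx) ?_)
    · exact D.apply_mem_center_of_forall_notMem_sdi (Set.disjoint_left.1 hd hx) fun y hy =>
        LocallyConstant.mulIndicator_of_notMem _ _ hy
    · rintro _ ⟨z, rfl⟩
      show (a.mulIndicator hU.compl) _ = 1
      by_cases hz : prepend m z ∈ sdi (m ++ [!b])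
      · exact LocallyConstant.mulIndicator_of_notMem _ hU.compl (fun h => h hz)
      · rw [LocallyConstant.mulIndicator_of_mem _ hU.compl hz]
        refine hm ⟨fun n => z (n + 1), ?_⟩
        have h0 : z 0 = b := by
          by_contra h0
          refine hz ⟨fun n => z (n + 1), ?_⟩
          rw [prepend_append, ← Bool.eq_not.2 h0]
          exact congrArg _ (cons_head_tail z)
        rw [prepend_append, ← h0]
        exact congrArg _ (cons_head_tail z)

/-- The germ of `u` at `x` is realised by an element supported where `a` is trivial, and such an
element fixes `a`. Centrality then removes the conjugation by the cocycle. -/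
theorem apply_smul_of_apply_eq_one {a : LoopGroup Γ} {x : Cantor} {u : ThompsonV} (hx : a x = 1)
    (hux : a (u • x) = 1) : D.κ a (D.φ (u • x)) = D.twist u x (D.κ a (D.φ x)) := by
  obtain ⟨v, hv, hvu⟩ := ThompsonV.exists_suppIn_germ_eq (isOpen_setOf_apply_eq a 1) hx hux
  have h := D.map_jonesAction_apply v a x
  rw [jonesAction_eq_self_of_suppIn α₀ α₁ hv, hvu.self_of_nhds, D.twist_congr hvu] at h
  have hc := D.apply_mem_center hux
  rw [h] at hc ⊢
  exact eq_of_conj_mem_center hc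

theorem exists_invariantCenter_extension (a : LoopGroup Γ) :
    ∃ z ∈ invariantCenter β₀ β₁, ∀ x, a x = 1 → z (D.φ x) = D.κ a (D.φ x) := by
  by_cases hW : ({x | a x = 1} : Set Cantor).Nonempty
  swap
  · exact ⟨1, Subgroup.one_mem _, fun x hx => (hW ⟨x, hx⟩).elim⟩
  choose u hu using fun x => ThompsonV.exists_smul_mem (isOpen_setOf_apply_eq a 1) hW x
  -- Each point is moved into the trivial locus of `a`, the value is read there and twisted back;
  -- `hF` is the independence of the moving element.
  let F : Cantor → Γ' := fun x => (D.twist (u x) x)⁻¹ (D.κ a (D.φ (u x • x)))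
  have hF : ∀ (v : ThompsonV) (x : Cantor), a (v • x) = 1 →
      F x = (D.twist v x)⁻¹ (D.κ a (D.φ (v • x))) := by
    intro v x hv
    have hux : a (u x • x) = 1 := hu x
    have hv' : v = (v * (u x)⁻¹) * u x := by group
    have hvx : v • x = (v * (u x)⁻¹) • u x • x := by rw [← mul_smul, ← hv']
    have h := D.apply_smul_of_apply_eq_one (u := v * (u x)⁻¹) hux (by rw [← hvx]; exact hv)
    rw [hvx, h]
    conv_rhs => rw [hv']
    rw [D.twist_mul, ← hv', mul_inv_rev, MulAut.mul_apply, MulAut.inv_apply_self]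
  have hFlc : IsLocallyConstant F := by
    rw [IsLocallyConstant.iff_eventually_eq]
    intro x
    have h₁ := (IsLocallyConstant.iff_eventually_eq _).1 (D.isLocallyConstant_twist (u x)) x
    have hcont : Continuous fun y : Cantor => D.φ (u x • y) :=
      D.φ.continuous.comp (continuous_const_smul (u x))
    have h₂ := (IsLocallyConstant.iff_eventually_eq _).1
      ((D.κ a).isLocallyConstant.comp_continuous hcont) x
    have h₃ : ∀ᶠ y in 𝓝 x, a (u x • y) = 1 :=
      (continuous_const_smul (u x)).continuousAt.eventually
        ((isOpen_setOf_apply_eq a 1).mem_nhds (hu x))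
    filter_upwards [h₁, h₂, h₃] with y hy₁ hy₂ hy₃
    have hy₂' : D.κ a (D.φ (u x • y)) = D.κ a (D.φ (u x • x)) := hy₂
    rw [hF (u x) y hy₃, hy₁, hy₂']
  have hFinv : ∀ (v : ThompsonV) (x : Cantor), F (v • x) = D.twist v x (F x) := by
    intro v x
    have h : a (u (v • x) • v • x) = 1 := hu (v • x)
    rw [hF (u (v • x) * v) x (by rwa [mul_smul]), D.twist_mul, mul_inv_rev, MulAut.mul_apply,
      MulAut.apply_inv_self, mul_smul]
  refine ⟨⟨fun y => F (D.φ.symm y), hFlc.comp_continuous D.φ.symm.continuous⟩, ⟨?_, ?_⟩, ?_⟩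
  · intro y
    exact map_mem_center (D.apply_mem_center (hu (D.φ.symm y))) _
  · intro w y
    obtain ⟨v, rfl⟩ := D.ψ.surjective w
    obtain ⟨x, rfl⟩ := D.φ.surjective y
    show F (D.φ.symm (D.ψ v • D.φ x)) = tau β₀ β₁ (D.ψ v) (D.φ x) (F (D.φ.symm (D.φ x)))
    rw [← D.map_smul, D.φ.symm_apply_apply, D.φ.symm_apply_apply]
    exact hFinv v x
  · intro x hx
    show F (D.φ.symm (D.φ x)) = _
    rw [D.φ.symm_apply_apply, hF 1 x (by rwa [one_smul]), one_smul, D.twist_eq_one (by simp)]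
    rfl

theorem exists_central_part : ∃ ζ : LoopGroup Γ →* LoopGroup Γ',
    (∀ a, ζ a ∈ invariantCenter β₀ β₁) ∧ (∀ v a, ζ (jonesAction α₀ α₁ v a) = ζ a) ∧
      ∀ a x, a x = 1 → ζ a (D.φ x) = D.κ a (D.φ x) := by
  choose z hz hza using D.exists_invariantCenter_extension
  have hmul : ∀ {a b : LoopGroup Γ} {x : Cantor}, a x = 1 → b x = 1 → z (a * b) = z a * z b := by
    intro a b x ha hb
    refine eq_of_mem_invariantCenter (hz _) (Subgroup.mul_mem _ (hz _) (hz _)) (y := D.φ x) ?_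
    rw [LocallyConstant.mul_apply, hza a x ha, hza b x hb, hza (a * b) x, map_mul,
      LocallyConstant.mul_apply]
    rw [LocallyConstant.mul_apply, ha, hb, one_mul]
  have hU := isClopen_sdi [false]
  have hout : ∀ (a : LoopGroup Γ) {x : Cantor} {U : Set Cantor} (hU : IsClopen U), x ∉ U →
      a.mulIndicator hU x = 1 := fun a x U hU hx => LocallyConstant.mulIndicator_of_notMem _ _ hx
  have hind : ∀ {U : Set Cantor} (hU : IsClopen U) (a b : LoopGroup Γ),
      (a * b).mulIndicator hU = a.mulIndicator hU * b.mulIndicator hU := by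
    intro U hU a b
    exact LocallyConstant.ext fun x => congrFun (Set.mulIndicator_mul' U a b) x
  obtain ⟨x₀, hx₀⟩ := sdi_nonempty [false]
  obtain ⟨x₁, hx₁⟩ := sdi_nonempty [true]
  have hx₁' : x₁ ∉ sdi [false] :=
    Set.disjoint_right.1
      (disjoint_sdi_of_length_eq (m := [false]) (w := [true]) rfl (by simp)) hx₁
  have hx₀' : x₀ ∉ (sdi [false])ᶜ := fun h => h hx₀
  -- The choice `z` need not be multiplicative on nowhere trivial loops, for which it is
  -- unconstrained. Cutting along a half makes each factor trivial at a fixed point, where `hmul`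
  -- applies.
  let ζ : LoopGroup Γ →* LoopGroup Γ' :=
    MonoidHom.mk' (fun a => z (a.mulIndicator hU) * z (a.mulIndicator hU.compl)) fun a b => by
      rw [hind, hind, hmul (hout a hU hx₁') (hout b hU hx₁'),
        hmul (hout a hU.compl hx₀') (hout b hU.compl hx₀')]
      exact Commute.mul_mul_mul_comm (commute_of_mem_invariantCenter (hz _) _) _ _
  have hζ : ∀ a, ζ a ∈ invariantCenter β₀ β₁ := fun a => Subgroup.mul_mem _ (hz _) (hz _)
  have hζκ : ∀ a x, a x = 1 → ζ a (D.φ x) = D.κ a (D.φ x) := by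
    intro a x hax
    have h : ∀ {U : Set Cantor} (hU : IsClopen U), a.mulIndicator hU x = 1 := by
      intro U hU
      by_cases hx : x ∈ U
      · rw [LocallyConstant.mulIndicator_of_mem _ _ hx, hax]
      · exact hout a hU hx
    show (z (a.mulIndicator hU) * z (a.mulIndicator hU.compl)) (D.φ x) = _
    rw [LocallyConstant.mul_apply, hza _ x (h hU), hza _ x (h hU.compl),
      ← LocallyConstant.mul_apply, ← map_mul, mulIndicator_mul_mulIndicator_compl]
  refine ⟨ζ, hζ, ?_, hζκ⟩
  have key : ∀ (v : ThompsonV) {a : LoopGroup Γ} {x : Cantor}, a x = 1 →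
      ζ (jonesAction α₀ α₁ v a) = ζ a := by
    intro v a x hax
    refine eq_of_mem_invariantCenter (hζ _) (hζ _) (y := D.φ (v • x)) ?_
    rw [hζκ _ _ (by rw [jonesAction_smul, hax, map_one]), D.map_jonesAction_apply,
      conj_eq_of_mem_center (map_mem_center (D.apply_mem_center hax) _),
      D.invariantCenter_apply_smul (hζ a), hζκ a x hax]
  intro v a
  rw [← mulIndicator_mul_mulIndicator_compl a hU, map_mul, map_mul, map_mul,
    key v (hout a hU hx₁'), key v (hout a hU.compl hx₀')]

end LoopIntertwiner

open Cantor

namespace LoopIntertwiner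

variable {Γ Γ' : Type*} [Group Γ] [Group Γ'] {α₀ α₁ : MulAut Γ} {β₀ β₁ : MulAut Γ'}
  (D : LoopIntertwiner α₀ α₁ β₀ β₁)

/-- The loop isomorphism is, up to a central part, given by a family of isomorphisms of the
fibres. -/
theorem exists_spatial_part : ∃ ζ : LoopGroup Γ →* LoopGroup Γ',
    (∀ a, ζ a ∈ invariantCenter β₀ β₁) ∧ (∀ v a, ζ (jonesAction α₀ α₁ v a) = ζ a) ∧
      ∃ κ : LoopGroup Γ ≃* LoopGroup Γ', (∀ a, D.κ a = ζ a * κ a) ∧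
        ∃ κₓ : Cantor → (Γ ≃* Γ'), (∀ a x, κ a (D.φ x) = κₓ x (a x)) ∧
          ∀ (x : Cantor) (v : ThompsonV) (g : Γ), κₓ (v • x) (tau α₀ α₁ v x g) =
            MulAut.conj (D.c v (D.φ (v • x))) (D.twist v x (κₓ x g)) := by
  obtain ⟨ζ, hζ, hζv, hζκ⟩ := D.exists_central_part
  refine ⟨ζ, hζ, hζv, ?_⟩
  let κ : LoopGroup Γ →* LoopGroup Γ' := MonoidHom.mk' (fun a => (ζ a)⁻¹ * D.κ a) fun a b => by
    have h := (commute_of_mem_invariantCenter (Subgroup.inv_mem _ (hζ b)) (D.κ a)).eq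
    rw [map_mul, map_mul, mul_inv_rev,
      (commute_of_mem_invariantCenter (Subgroup.inv_mem _ (hζ b)) (ζ a)⁻¹).eq]
    calc (ζ a)⁻¹ * (ζ b)⁻¹ * (D.κ a * D.κ b) = (ζ a)⁻¹ * ((ζ b)⁻¹ * D.κ a) * D.κ b := by group
      _ = _ := by rw [h]; group
  have hκ : ∀ a, D.κ a = ζ a * κ a := fun a => (mul_inv_cancel_left _ _).symm
  have hκ_apply : ∀ a y, κ a y = (ζ a y)⁻¹ * D.κ a y := fun a y => rfl
  have hlocal₁ : ∀ {a : LoopGroup Γ} {x : Cantor}, a x = 1 → κ a (D.φ x) = 1 := by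
    intro a x hax
    rw [hκ_apply, hζκ a x hax, inv_mul_cancel]
  have hlocal : ∀ {a b : LoopGroup Γ} {x : Cantor}, a x = b x → κ a (D.φ x) = κ b (D.φ x) := by
    intro a b x hab
    have h : κ (a * b⁻¹) (D.φ x) = 1 := hlocal₁ (by
      rw [LocallyConstant.mul_apply, LocallyConstant.inv_apply, hab, mul_inv_cancel])
    rw [map_mul, map_inv, LocallyConstant.mul_apply, LocallyConstant.inv_apply] at h
    exact mul_inv_eq_one.1 h
  have hequiv : ∀ v a x, κ (jonesAction α₀ α₁ v a) (D.φ (v • x)) =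
      MulAut.conj (D.c v (D.φ (v • x))) (D.twist v x (κ a (D.φ x))) := by
    intro v a x
    have h := Subgroup.mem_center_iff.1 (Subgroup.inv_mem _ ((hζ a).1 (D.φ (v • x))))
      (D.c v (D.φ (v • x)))
    rw [hκ_apply, hκ_apply, hζv, D.map_jonesAction_apply, map_mul, map_inv,
      ← D.invariantCenter_apply_smul (hζ a), MulAut.conj_apply, ← mul_assoc, ← mul_assoc,
      ← mul_assoc, h]
  -- If `κ a = 1` then `D.κ a` is the invariant central loop `ζ a`, so `a` itself is fixed by `V`;
  -- with one trivial value it must be trivial.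
  have hinj₁ : ∀ a x, a x = 1 → κ a = 1 → a = 1 := by
    intro a x hax ha
    have hκa : D.κ a ∈ invariantCenter β₀ β₁ := by
      rw [hκ, ha, mul_one]
      exact hζ a
    refine eq_one_of_forall_smul_of_apply_eq_one (α₀ := α₀) (α₁ := α₁) (fun v y => ?_) hax
    have h : jonesAction α₀ α₁ v a = a := by
      apply D.κ.injective
      rw [D.map_jonesAction, jonesAction_of_mem_invariantCenter hκa,
        ← (commute_of_mem_invariantCenter hκa _).eq, mul_inv_cancel_right]
    rw [← jonesAction_smul, h]
  have hU : ∀ i, IsClopen (sdi [i]) := fun i => isClopen_sdi [i]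
  have hnot : ∀ i : Bool, ∃ x, x ∉ sdi [i] := fun i => by
    obtain ⟨x, hx⟩ := sdi_nonempty [!i]
    rw [← sdi_bool_compl] at hx
    exact ⟨x, hx⟩
  have hin : ∀ (a : LoopGroup Γ) {U : Set Cantor} (hU : IsClopen U) {x}, x ∈ U →
      a.mulIndicator hU x = a x := fun a U hU x hx => LocallyConstant.mulIndicator_of_mem _ _ hx
  have hout : ∀ (a : LoopGroup Γ) {U : Set Cantor} (hU : IsClopen U) {x}, x ∉ U →
      a.mulIndicator hU x = 1 := fun a U hU x hx => LocallyConstant.mulIndicator_of_notMem _ _ hx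
  have hpoint : ∀ {a : LoopGroup Γ} {x : Cantor}, κ a (D.φ x) = 1 → a x = 1 := by
    intro a x hax
    -- Length at least 1 makes the interval proper, so the loop cut off to it is trivial somewhere,
    -- as `hinj₁` requires.
    obtain ⟨m, hm, hx, hmsub⟩ := exists_sdi_subset
      ((isOpen_setOf_apply_eq (κ a) 1).preimage D.φ.continuous) hax 1
    obtain ⟨b, m, rfl⟩ := List.exists_cons_of_ne_nil (l := m) (by rintro rfl; simp at hm)
    have hcl := isClopen_sdi (b :: m)
    obtain ⟨y, hy⟩ := hnot b
    have h : a.mulIndicator hcl = 1 := by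
      refine hinj₁ _ y (hout a hcl fun h => hy (sdi_append_subset [b] m h)) ?_
      refine LocallyConstant.ext fun t => ?_
      obtain ⟨t, rfl⟩ := D.φ.surjective t
      by_cases ht : t ∈ sdi (b :: m)
      · rw [hlocal (hin a hcl ht)]
        exact hmsub ht
      · exact hlocal₁ (hout a hcl ht)
    rw [← hin a hcl hx, h]
    rfl
  have hinj : Function.Injective κ := by
    rw [injective_iff_map_eq_one]
    intro a ha
    exact LocallyConstant.ext fun x => hpoint (by rw [ha]; rfl)
  have hsurj₁ : ∀ (i : Bool) (b : LoopGroup Γ'), (∀ x ∈ sdi [i], b (D.φ x) = 1) →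
      ∃ a, κ a = b := by
    intro i b hb
    obtain ⟨a, rfl⟩ := D.κ.surjective b
    obtain ⟨s, hs, -⟩ := ThompsonV.exists_swap (a := [i]) (b := [!i])
      (disjoint_sdi_of_length_eq rfl (by simp))
    have hae : ∀ x ∈ sdi [i], κ a⁻¹ (D.φ x) = ζ a (D.φ x) := by
      intro x hx
      rw [map_inv, LocallyConstant.inv_apply, hκ_apply, hb x hx, mul_one, inv_inv]
    -- Where `b` is trivial, `κ a⁻¹` already agrees with `ζ a`. The swap copies this to the other
    -- half because `ζ a` is invariant and central; then `κ (e * a) = ζ a * κ a = b`.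
    let e := (a⁻¹).mulIndicator (hU i) * (jonesAction α₀ α₁ s a⁻¹).mulIndicator (hU i).compl
    have he : κ e = ζ a := by
      refine LocallyConstant.ext fun y => ?_
      obtain ⟨x, rfl⟩ := D.φ.surjective y
      by_cases hx : x ∈ sdi [i]
      · rw [← hae x hx]
        apply hlocal
        show (a⁻¹).mulIndicator (hU i) x *
          (jonesAction α₀ α₁ s a⁻¹).mulIndicator (hU i).compl x = _
        rw [hin _ _ hx, hout _ (hU i).compl (fun h => h hx), mul_one]
      · have hx' : x ∈ sdi [!i] := by rw [← sdi_bool_compl]; exact hx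
        obtain ⟨t, rfl⟩ := hx'
        rw [← hs] at hx ⊢
        have h : e (s • prepend [i] t) = jonesAction α₀ α₁ s a⁻¹ (s • prepend [i] t) := by
          show (a⁻¹).mulIndicator (hU i) _ *
            (jonesAction α₀ α₁ s a⁻¹).mulIndicator (hU i).compl _ = _
          rw [hin _ (hU i).compl hx, hout _ (hU i) hx, one_mul]
        rw [hlocal h, hequiv, hae _ ⟨t, rfl⟩, ← D.invariantCenter_apply_smul (hζ a),
          MulAut.conj_apply, conj_eq_of_mem_center ((hζ a).1 _)]
    exact ⟨e * a, by rw [map_mul, he, ← hκ]⟩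
  have hsurj : Function.Surjective κ := by
    intro b
    have hφU : ∀ i, IsClopen (D.φ.symm ⁻¹' sdi [i]) := fun i =>
      (hU i).preimage D.φ.symm.continuous
    obtain ⟨a, ha⟩ := hsurj₁ true (b.mulIndicator (hφU false)) fun x hx => by
      refine LocallyConstant.mulIndicator_of_notMem _ _ ?_
      rw [Set.mem_preimage, D.φ.symm_apply_apply, ← Set.mem_compl_iff, sdi_bool_compl]
      exact hx
    obtain ⟨a', ha'⟩ := hsurj₁ false (b.mulIndicator (hφU false).compl) fun x hx => by
      refine LocallyConstant.mulIndicator_of_notMem _ _ fun h => h ?_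
      rw [Set.mem_preimage, D.φ.symm_apply_apply]
      exact hx
    exact ⟨a * a', by rw [map_mul, ha, ha', mulIndicator_mul_mulIndicator_compl]⟩
  let κₓ : Cantor → (Γ →* Γ') := fun x =>
    { toFun := fun g => κ (LocallyConstant.const _ g) (D.φ x)
      map_one' := hlocal₁ rfl
      map_mul' := fun g h => by
        rw [← LocallyConstant.mul_apply, ← map_mul]
        rfl }
  have hκₓ : ∀ a x, κ a (D.φ x) = κₓ x (a x) := fun a x => hlocal rfl
  have hbij : ∀ x, Function.Bijective (κₓ x) := by
    intro x
    constructor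
    · rw [injective_iff_map_eq_one]
      exact fun g hg => hpoint (a := LocallyConstant.const _ g) hg
    · intro h
      obtain ⟨a, ha⟩ := hsurj (LocallyConstant.const _ h)
      exact ⟨a x, by rw [← hκₓ, ha]; rfl⟩
  refine ⟨MulEquiv.ofBijective κ ⟨hinj, hsurj⟩, hκ, fun x => MulEquiv.ofBijective (κₓ x) (hbij x),
    hκₓ, fun x v g => ?_⟩
  have h := hequiv v (LocallyConstant.const _ g) x
  rw [hκₓ, jonesAction_smul] at h
  exact h

end LoopIntertwiner

/-! ### Splitting the isomorphism of fraction groups -/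

section Main

open SemidirectProduct

variable {Γ Γ' : Type*} [Group Γ] [Group Γ'] {α₀ α₁ : MulAut Γ} {β₀ β₁ : MulAut Γ'}

theorem right_map_inl (θ : FractionGroup α₀ α₁ ≃* FractionGroup β₀ β₁) (a : LoopGroup Γ) :
    (θ (inl a)).right = 1 :=
  map_inl_eq_one α₀ α₁ (rightHom.comp θ.toMonoidHom)
    (rightHom_surjective.comp θ.surjective) a

theorem map_inl_eq_inl (θ : FractionGroup α₀ α₁ ≃* FractionGroup β₀ β₁) (a : LoopGroup Γ) :
    θ (inl a) = inl (θ (inl a)).left := by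
  ext1
  · rw [left_inl]
  · rw [right_map_inl, right_inl]

theorem right_symm_inr_right_map_inr (θ : FractionGroup α₀ α₁ ≃* FractionGroup β₀ β₁)
    (v : ThompsonV) : (θ.symm (inr (θ (inr v)).right)).right = v := by
  have h := congrArg (fun g => (θ.symm g).right) (inl_left_mul_inr_right (θ (inr v)))
  simpa only [map_mul, mul_right, right_map_inl, one_mul, θ.symm_apply_apply, right_inr] using h

/-- The automorphism of `V` induced by an isomorphism of fraction groups. -/
noncomputable def inducedAut (θ : FractionGroup α₀ α₁ ≃* FractionGroup β₀ β₁) : ThompsonV ≃* ThompsonV where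
  toFun v := (θ (inr v)).right
  invFun v := (θ.symm (inr v)).right
  left_inv := right_symm_inr_right_map_inr θ
  right_inv := right_symm_inr_right_map_inr θ.symm
  map_mul' v w := by rw [map_mul, map_mul, mul_right]

/-- The isomorphism of loop groups induced by an isomorphism of fraction groups. -/
noncomputable def inducedLoopEquiv (θ : FractionGroup α₀ α₁ ≃* FractionGroup β₀ β₁) :
    LoopGroup Γ ≃* LoopGroup Γ' where
  toFun a := (θ (inl a)).left
  invFun a := (θ.symm (inl a)).left
  left_inv a := by beta_reduce; rw [← map_inl_eq_inl, θ.symm_apply_apply, left_inl]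
  right_inv a := by beta_reduce; rw [← map_inl_eq_inl θ.symm, θ.apply_symm_apply, left_inl]
  map_mul' a b := by
    rw [map_mul, map_mul, mul_left, right_map_inl, map_one, MulAut.one_apply]

theorem map_inl_eq_inl_inducedLoopEquiv (θ : FractionGroup α₀ α₁ ≃* FractionGroup β₀ β₁)
    (a : LoopGroup Γ) : θ (inl a) = inl (inducedLoopEquiv θ a) :=
  map_inl_eq_inl θ a

theorem map_inr_eq (θ : FractionGroup α₀ α₁ ≃* FractionGroup β₀ β₁) (v : ThompsonV) :
    θ (inr v) = inl (θ (inr v)).left * inr (inducedAut θ v) :=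
  (inl_left_mul_inr_right _).symm

/-- In a fraction group the Jones action is conjugation by `inr v`, whose image has a loop part and
a `V` part; the loop part gives the conjugation by the cocycle. -/
theorem inducedLoopEquiv_jonesAction (θ : FractionGroup α₀ α₁ ≃* FractionGroup β₀ β₁)
    (v : ThompsonV) (a : LoopGroup Γ) : inducedLoopEquiv θ (jonesAction α₀ α₁ v a) =
      (θ (inr v)).left * jonesAction β₀ β₁ (inducedAut θ v) (inducedLoopEquiv θ a) *
        (θ (inr v)).left⁻¹ := by
  apply inl_injective (φ := jonesAction β₀ β₁)
  rw [← map_inl_eq_inl_inducedLoopEquiv, inl_aut, map_mul, map_mul, map_inv, map_inv, map_mul,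
    map_mul, map_inv, inl_aut, map_inl_eq_inl_inducedLoopEquiv]
  generalize hc : (θ (inr v)).left = c
  rw [map_inr_eq θ v, hc, map_inv]
  group

theorem left_map_inr_mul (θ : FractionGroup α₀ α₁ ≃* FractionGroup β₀ β₁) (v w : ThompsonV) :
    (θ (inr (v * w))).left =
      (θ (inr v)).left * jonesAction β₀ β₁ (inducedAut θ v) (θ (inr w)).left := by
  rw [map_mul, map_mul, mul_left]
  rfl

theorem mem_normalizer_of_map_smul {ψ : ThompsonV ≃* ThompsonV} {φ : Cantor ≃ₜ Cantor}
    (h : ∀ (v : ThompsonV) (x : Cantor), φ (v • x) = ψ v • φ x) :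
    φ ∈ Subgroup.normalizer (ThompsonV : Set (Cantor ≃ₜ Cantor)) := by
  have hconj : ∀ v : ThompsonV, φ * v.1 * φ⁻¹ = (ψ v).1 := by
    intro v
    ext1 y
    obtain ⟨x, rfl⟩ := φ.surjective y
    rw [Homeomorph.mul_apply, Homeomorph.mul_apply, Homeomorph.inv_apply, φ.symm_apply_apply]
    exact h v x
  intro g
  constructor
  · intro hg
    rw [hconj ⟨g, hg⟩]
    exact (ψ _).2
  · intro hg
    obtain ⟨v, hv⟩ := ψ.surjective ⟨_, hg⟩
    have h' : φ * v.1 * φ⁻¹ = φ * g * φ⁻¹ := by rw [hconj, hv]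
    have hvg : v.1 = g := mul_left_cancel (mul_right_cancel h')
    rw [← hvg]
    exact v.2

theorem ad_eq_of_map_smul {ψ : ThompsonV ≃* ThompsonV}
    {φ : Subgroup.normalizer (ThompsonV : Set (Cantor ≃ₜ Cantor))}
    (h : ∀ (v : ThompsonV) (x : Cantor), φ.1 (v • x) = ψ v • φ.1 x) (v : ThompsonV) :
    ThompsonV.ad φ v = ψ v := by
  refine eq_of_smul_eq_smul (α := Cantor) fun y => ?_
  obtain ⟨x, rfl⟩ := φ.1.surjective y
  rw [← h]
  show φ.1 (v.1 (φ.1.symm (φ.1 x))) = _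
  rw [φ.1.symm_apply_apply]
  rfl

end Main


theorem theorem2 {Γ Γ' : Type*} [Group Γ] [Group Γ'] (α₀ α₁ : MulAut Γ) (β₀ β₁ : MulAut Γ')
    (θ : FractionGroup α₀ α₁ ≃* FractionGroup β₀ β₁) :
    ∃ (ζ : FractionGroup α₀ α₁ →* Subgroup.center (FractionGroup β₀ β₁))
      (φ : Subgroup.normalizer (ThompsonV : Set (Cantor ≃ₜ Cantor)))
      (κ : LoopGroup Γ ≃* LoopGroup Γ')
      (c : ThompsonV → LoopGroup Γ'),
      (∀ v w : ThompsonV, c (v * w) = c v * jonesAction β₀ β₁ (ThompsonV.ad φ v) (c w)) ∧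
      (∀ (a : LoopGroup Γ) (v : ThompsonV),
        θ (SemidirectProduct.inl a * SemidirectProduct.inr v) =
          (ζ (SemidirectProduct.inl a) : FractionGroup β₀ β₁) * SemidirectProduct.inl (κ a) *
            SemidirectProduct.inl (c v) * SemidirectProduct.inr (ThompsonV.ad φ v)) ∧
      (∀ a : LoopGroup Γ,
        Function.mulSupport (κ a) = (φ : Cantor ≃ₜ Cantor) '' Function.mulSupport a) ∧
      ∃ κₓ : Cantor → (Γ ≃* Γ'),
        (∀ (a : LoopGroup Γ) (x : Cantor), κ a ((φ : Cantor ≃ₜ Cantor) x) = κₓ x (a x)) ∧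
        ∀ (x : Cantor) (v : ThompsonV) (g : Γ),
          κₓ ((v : Cantor ≃ₜ Cantor) x) (tau α₀ α₁ v x g) =
            MulAut.conj (c v ((φ : Cantor ≃ₜ Cantor) ((v : Cantor ≃ₜ Cantor) x)))
              (tau β₀ β₁ (ThompsonV.ad φ v) ((φ : Cantor ≃ₜ Cantor) x) (κₓ x g)) := by
  obtain ⟨φ, hφ⟩ := ThompsonV.exists_homeomorph_of_mulEquiv (inducedAut θ)
  let D : LoopIntertwiner α₀ α₁ β₀ β₁ :=
    { ψ := inducedAut θ
      φ := φ
      κ := inducedLoopEquiv θ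
      c := fun v => (θ (SemidirectProduct.inr v)).left
      map_smul := hφ
      map_jonesAction := inducedLoopEquiv_jonesAction θ }
  obtain ⟨ζ, hζ, hζv, κ, hκ, κₓ, hκₓ, hτ⟩ := D.exists_spatial_part
  let Φ : Subgroup.normalizer (ThompsonV : Set (Cantor ≃ₜ Cantor)) :=
    ⟨φ, mem_normalizer_of_map_smul hφ⟩
  have had : ∀ v, ThompsonV.ad Φ v = inducedAut θ v := ad_eq_of_map_smul hφ
  -- Forgetting the `V` component is not a morphism; the composite with `ζ` is, because `ζ` is
  -- invariant under the Jones action.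
  let Z : FractionGroup α₀ α₁ →* Subgroup.center (FractionGroup β₀ β₁) :=
    MonoidHom.mk' (fun g => ⟨SemidirectProduct.inl (ζ g.left), inl_mem_center (hζ _)⟩)
      fun g h => Subtype.ext <| by
        show SemidirectProduct.inl (ζ (g * h).left) = _
        rw [SemidirectProduct.mul_left, map_mul, hζv, map_mul]
        rfl
  refine ⟨Z, Φ, κ, D.c, ?_, ?_, ?_, κₓ, hκₓ, ?_⟩
  · intro v w
    rw [had]
    exact left_map_inr_mul θ v w
  · intro a v
    have hZ : (Z (SemidirectProduct.inl a) : FractionGroup β₀ β₁) =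
        SemidirectProduct.inl (ζ a) := rfl
    have hκa : inducedLoopEquiv θ a = ζ a * κ a := hκ a
    rw [map_mul, map_inl_eq_inl_inducedLoopEquiv, hκa, map_inr_eq, had, hZ, map_mul, ← mul_assoc]
  · intro a
    ext y
    obtain ⟨x, rfl⟩ := φ.surjective y
    rw [Function.mem_mulSupport, hκₓ, Ne, map_eq_one_iff _ (κₓ x).injective]
    exact ⟨fun h => ⟨x, h, rfl⟩, by rintro ⟨x', h, hx⟩; rwa [← φ.injective hx]⟩
  · intro x v g
    rw [had]
    exact hτ x v g
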